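/- Let $G$ be a finite group, let $p$ be a prime number, and let $G_p$ be a $p$-Sylow subgroup of $G$. A $G$-lattice is a free abelian group of finite rank with a linear action of $G$; it is a permutation $G$-lattice if it has a $\mathbb{Z}$-basis permuted by $G$. A $G$-lattice $M$ is flasque if the Tate cohomology group $\hat{H}^{-1}(H,M)$ vanishes for every subgroup $H\subseteq G$. A $G$-lattice $M$ is $p$-invertible if there is a permutation $G$-lattice $P$ such that $M_{(p)}:=M\otimes_{\mathbb{Z}}\mathbb{Z}_{(p)}$ is a direct summand of $P_{(p)}$ as a $\mathbb{Z}_{(p)}[G]$-module. Two $G$-lattices $M,N$ are stably equivalent if $M\oplus P\cong N\oplus Q$ for some permutation $G$-lattices $P,Q$. The flasque class $[M]^{\mathrm{fl}}$ is the stable equivalence class of $F$, for any exact sequence of $G$-lattices $0\to M\to P\to F\to 0$ with $P$ permutation and $F$ flasque (the class does not depend on the choice); it is called $p$-invertible if some $G$-lattice in it is $p$-invertible. Let $\epsilon:\mathbb{Z}[G]\to\mathbb{Z}$ be the augmentation map, given by $\epsilon(g)=1$ for every $g\in G$, let $I_G:=\ker\epsilon$, and let $J_G:=\operatorname{Hom}_{\mathbb{Z}}(I_G,\mathbb{Z})$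 be its dual $G$-lattice. The following conditions are equivalent: (1) $G_p$ is cyclic; (2) every flasque $G$-lattice is $p$-invertible; (3) $[J_G]^{\mathrm{fl}}$ is $p$-invertible. -/

import Mathlib

/-- A `G`-lattice: a free abelian group of finite rank with a `ℤ`-linear action of `G`. -/
structure GLattice (G : Type) [Group G] where
  carrier : Type
  [addCommGroup : AddCommGroup carrier]
  [free : Module.Free ℤ carrier]
  [finite : Module.Finite ℤ carrier]
  ρ : Representation ℤ G carrier

namespace GLattice

attribute [instance] addCommGroup free finite

section Basic

variable {G : Type} [Group G]

/-- A permutation `G`-lattice: there is a `ℤ`-basis which is permuted by `G`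
(it is automatically finite). -/
def IsPermutation (M : GLattice G) : Prop :=
  ∃ (X : Type) (b : Module.Basis X ℤ M.carrier), ∀ (g : G) (x : X), ∃ y : X, M.ρ g (b x) = b y

/-- Stable equivalence: `M ⊕ P ≅ N ⊕ Q` for some permutation `G`-lattices `P` and `Q`. -/
def StablyEquivalent (M N : GLattice G) : Prop :=
  ∃ P Q : GLattice G, P.IsPermutation ∧ Q.IsPermutation ∧
    Nonempty ((M.ρ.prod P.ρ).Equiv (N.ρ.prod Q.ρ))

/-- The restriction of `M` to a subgroup `H`, as an object of Mathlib's category `Rep ℤ H`. -/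
abbrev resRep (M : GLattice G) (H : Subgroup G) : Rep.{0} ℤ H :=
  Rep.of (M.ρ.comp H.subtype)

/-- A flasque `G`-lattice (`G` finite): the Tate cohomology group `Ĥ⁻¹(H, M)` vanishes for every
subgroup `H` of `G`. -/
def IsFlasque [Finite G] (M : GLattice G) : Prop :=
  ∀ (H : Subgroup G) [Fintype H], Subsingleton (tateCohomology (M.resRep H) (-1))

/-- `F` is the last term of a flasque resolution `0 → M → P → F → 0` of `M`: an exact sequence of
`G`-lattices with `P` permutation and `F` flasque. -/
def HasFlasqueResolution [Finite G] (M F : GLattice G) : Prop :=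
  F.IsFlasque ∧ ∃ (P : GLattice G) (i : M.ρ.IntertwiningMap P.ρ) (q : P.ρ.IntertwiningMap F.ρ),
    P.IsPermutation ∧ Function.Injective i ∧ Function.Exact i q ∧ Function.Surjective q

/-- The flasque class `[M]^fl`: all `G`-lattices stably equivalent to the last term `F` of a flasque
resolution `0 → M → P → F → 0`. -/
def flasqueClass [Finite G] (M : GLattice G) : Set (GLattice G) :=
  {F' | ∃ F : GLattice G, M.HasFlasqueResolution F ∧ F'.StablyEquivalent F}

end Basic

section PInvertible

variable (p : ℕ) [Fact p.Prime] {G : Type} [Group G]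

instance isPrime_span : (Ideal.span {(p : ℤ)}).IsPrime :=
  (Ideal.span_singleton_prime (Int.natCast_ne_zero.mpr (Fact.out : p.Prime).ne_zero)).mpr
    (Nat.prime_iff_prime_int.mp Fact.out)

/-- The set of integers not divisible by `p`. The localizations of `ℤ` and of `ℤ`-modules at the
prime ideal `(p)` are formed with respect to it. -/
abbrev compl : Submonoid ℤ := (Ideal.span {(p : ℤ)}).primeCompl

/-- The action of `G` on the localization `M_(p) = M ⊗ ℤ_(p)`, as a `ℤ_(p)`-linear
representation. -/
noncomputable def localize (M : GLattice G) :
    Representation (Localization (compl p)) G (LocalizedModule (compl p) M.carrier) where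
  toFun g := LocalizedModule.map (compl p) (M.ρ g)
  map_one' := by
    rw [map_one]
    exact LocalizedModule.map_id _
  map_mul' g h := by
    rw [map_mul]
    exact LinearMap.ext fun x => by
      induction x using LocalizedModule.induction_on with
      | h m s => simp [LocalizedModule.map_mk]

/-- `M` is `p`-invertible: there is a permutation `G`-lattice `P` such that `M_(p)` is a direct
summand of `P_(p)` as a `ℤ_(p)`-linear representation of `G`, that is, there are `G`-equivariant
`ℤ_(p)`-linear maps `i : M_(p) → P_(p)` and `r : P_(p) → M_(p)` with `r ∘ i = id`. -/
def IsPInvertible (M : GLattice G) : Prop :=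
  ∃ P : GLattice G, P.IsPermutation ∧
    ∃ (i : (M.localize p).IntertwiningMap (P.localize p))
      (r : (P.localize p).IntertwiningMap (M.localize p)), ∀ x, r (i x) = x

/-- The flasque class `[M]^fl` is `p`-invertible: some `G`-lattice in it is. -/
def FlasqueClassIsPInvertible [Finite G] (M : GLattice G) : Prop :=
  ∃ F ∈ M.flasqueClass, F.IsPInvertible p

end PInvertible

section Augmentation

variable (G : Type) [Group G]

/-- The augmentation map `ε : ℤ[G] → ℤ`, `ε(g) = 1`, as a map of representations from the left
regular representation to the trivial one. -/
noncomputable def augmentation :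
    (Representation.leftRegular ℤ G).IntertwiningMap (Representation.trivial ℤ G ℤ) :=
  (Representation.leftRegularMapEquiv (Representation.trivial ℤ G ℤ)).symm 1

/-- The augmentation ideal `I_G = ker ε`, as a `G`-lattice. -/
noncomputable def augIdeal [Finite G] : GLattice G where
  carrier := (augmentation G).ker.toSubmodule
  ρ := (augmentation G).ker.toRepresentation

/-- `J_G`, the dual of `I_G`, with `(g • f)(x) = f(g⁻¹ • x)`. -/
noncomputable def JG [Finite G] : GLattice G where
  carrier := Module.Dual ℤ (augIdeal G).carrier
  ρ := (augIdeal G).ρ.dual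

end Augmentation

end GLattice

/-! The proof runs through the cycle cyclic Sylow ⇒ all flasques ⇒ `[J_G]^fl` ⇒ cyclic Sylow.
Throughout, `H¹` and `Ĥ⁻¹` are handled as explicit equations between elements.

Cyclic Sylow ⇒ flasques are `p`-invertible. Over `R = ℤ_(p)`, let `σ` generate a cyclic group `C` of
order `p ^ (n + 1)` and put `τ = σ ^ p ^ n`. The kernel `L` of `1 + τ + ⋯ + τ ^ (p - 1) = Φ(σ)`,
where `Φ` is the cyclotomic polynomial of order `p ^ (n + 1)`, is a module over `R[ζ]`, a principal
ideal domain, hence free. Vanishing of `Ĥ⁻¹` makes each basis vector of `L` a difference `τ m - m`,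
and the coordinates of `τ x - x` lift equivariantly from `R[ζ]` to `R[C]`. So the identity of `M` is
the sum of a map into the fixed module `M^τ` and a map through a free `R[C]`-module. Since `M^τ`
inherits the hypothesis for a group of order `p ^ n`, induction applies
(`isPermutationSummand_of_forall_exists`). Induction from the Sylow subgroup, whose index is a unit
in `R`, gives the result for `G` (`isPInvertible_of_subgroup`).

All flasques ⇒ `[J_G]^fl`. It suffices that `J_G` has some flasque resolution. Embed `J_G` in the
functions on `G × G`; the cokernel is flasque because this module is free over each subgroup and
`Ĥ⁰(H, J_G) = Hom(H, ℤ) = 0` (`exists_hasFlasqueResolution_JG`).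

`[J_G]^fl` ⇒ cyclic Sylow. Let `H` have order `N` and be killed by `m`. The element `∑ h - N · 1` of
`I_G` gives an `H`-invariant form `J_G → ℤ/N`. The obstruction to extending it invariantly to `P`
lies in `H¹(H, Hom(F, ℤ/N))`. If `F` is a summand of a permutation lattice up to `s`, this class is
killed by `m * s`, because stabilizers contribute only homomorphisms (`exists_nsmul_eq_coboundary`).
An invariant form on `P` with values in `ℤ/N` lifts to `ℤ`, and an invariant integral form on `J_G`
has a vanishing sum over a transversal of `H`. Comparing modulo `N` yields `N ∣ m * s`
(`natCard_dvd_mul`). For a noncyclic group of order `p ^ n` one may take `m = p ^ (n - 1)`, which is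
impossible when `p ∤ s`. -/

/-! ### Tate cohomology in degree -1, in terms of elements -/

open CategoryTheory in
theorem subsingleton_tateCohomology_neg_one_iff {G : Type} [Group G] [Fintype G] (A : Rep.{0} ℤ G) :
    Subsingleton (tateCohomology A (-1)) ↔
      ∀ x : A, ∑ g, A.ρ g x = 0 → ∃ f : G → A, x = ∑ g, (A.ρ g (f g) - f g) := by
  have h1 : Subsingleton (tateCohomology A (-1)) ↔
      Limits.IsZero ((tateComplex A).homology (-1)) :=
    ModuleCat.isZero_iff_subsingleton.symm
  rw [h1, ← HomologicalComplex.exactAt_iff_isZero_homology,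
    HomologicalComplex.exactAt_iff' _ (-2) (-1) 0 (by simp) (by simp)]
  let S : ShortComplex (ModuleCat ℤ) :=
    ShortComplex.mk (groupHomology.d₁₀ A) A.norm.toModuleCatHom (Rep.comp_eq_zero A)
  let e : (tateComplex A).sc' (-2) (-1) 0 ≅ S :=
    ShortComplex.isoMk (groupHomology.chainsIso₁ A) (groupHomology.chainsIso₀ A)
      (groupCohomology.cochainsIso₀ A) (groupHomology.comp_d₁₀_eq A)
      (by
        change _ = A.tateNorm ≫ _
        simp only [Rep.tateNorm, S, Category.assoc, Iso.inv_hom_id, Category.comp_id]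
        rfl)
  rw [ShortComplex.exact_iff_of_iso e, ShortComplex.moduleCat_exact_iff]
  have hd : ∀ f : G → A, (groupHomology.d₁₀ A).hom (Finsupp.equivFunOnFinite.symm f) =
      ∑ g, (A.ρ g⁻¹ (f g) - f g) := by
    intro f
    rw [Finsupp.equivFunOnFinite_symm_eq_sum, map_sum]
    exact Finset.sum_congr rfl fun g _ => groupHomology.d₁₀_single A g (f g)
  have hn : ∀ x : A, A.norm.toModuleCatHom.hom x = ∑ g, A.ρ g x := by
    intro x
    simp [Representation.norm]
  refine forall_congr' fun x => ?_
  change (A.norm.toModuleCatHom.hom x = 0 → ∃ y, (groupHomology.d₁₀ A).hom y = x) ↔ _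
  rw [hn]
  refine imp_congr_right fun _ => ⟨?_, ?_⟩
  · rintro ⟨y, rfl⟩
    -- The differential sends a chain `a` at `g` to `g⁻¹ a - a`, hence the inversion of indices.
    refine ⟨fun g => y g⁻¹, ?_⟩
    rw [← Finsupp.equivFunOnFinite.symm_apply_apply y, hd]
    exact Fintype.sum_equiv (Equiv.inv G) _ _ (by simp)
  · rintro ⟨f, rfl⟩
    refine ⟨Finsupp.equivFunOnFinite.symm fun g => f g⁻¹, ?_⟩
    rw [hd]
    exact Fintype.sum_equiv (Equiv.inv G) _ _ (by simp)

/-! ### Localization at `p` and clearing of denominators -/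

namespace LocalizedModule

variable {A : Type*} [CommRing A] (S : Submonoid A) {M N : Type*} [AddCommGroup M] [Module A M]
  [AddCommGroup N] [Module A N]

theorem mkLinearMap_smul (a : A) (x : M) :
    mkLinearMap S M (a • x) = algebraMap A (Localization S) a • mkLinearMap S M x := by
  rw [map_smul, algebraMap_smul]

theorem mkLinearMap_injective [IsDomain A] [Module.IsTorsionFree A M] (hS : S ≤ nonZeroDivisors A) :
    Function.Injective (mkLinearMap S M) :=
  (IsLocalizedModule.injective_iff_isRegular S (mkLinearMap S M)).mpr fun c =>
    IsSMulRegular.of_ne_zero (nonZeroDivisors.ne_zero (hS c.2))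

theorem exists_linearMap_of_finitePresentation [Module.FinitePresentation A M]
    (f : LocalizedModule S M →ₗ[Localization S] LocalizedModule S N) :
    ∃ (g : M →ₗ[A] N) (s : S), ∀ x, mkLinearMap S N (g x) =
      algebraMap A (Localization S) s • f (mkLinearMap S M x) := by
  obtain ⟨h, s, hs⟩ := Module.FinitePresentation.exists_lift_of_isLocalizedModule S
    (mkLinearMap S N) ((f.restrictScalars A) ∘ₗ mkLinearMap S M)
  exact ⟨h, s, fun x => (LinearMap.congr_fun hs x).trans
    (algebraMap_smul (Localization S) (s : A) _).symm⟩

end LocalizedModule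

namespace GLattice

theorem isFlasque_iff {G : Type} [Group G] [Finite G] (M : GLattice G) :
    M.IsFlasque ↔ ∀ (H : Subgroup G) [Fintype H] (x : M.carrier), ∑ h : H, M.ρ h x = 0 →
      ∃ f : H → M.carrier, x = ∑ h : H, (M.ρ h (f h) - f h) :=
  forall₂_congr fun H _ => subsingleton_tateCohomology_neg_one_iff (M.resRep H)

section

variable {p : ℕ} [Fact p.Prime] {G : Type} [Group G]

theorem mem_compl_iff {s : ℤ} : s ∈ compl p ↔ ¬ (p : ℤ) ∣ s := by
  rw [Ideal.mem_primeCompl_iff, Ideal.mem_span_singleton]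

theorem compl_le_nonZeroDivisors : compl p ≤ nonZeroDivisors ℤ := fun _ hs =>
  mem_nonZeroDivisors_of_ne_zero fun h => mem_compl_iff.mp hs (h ▸ dvd_zero _)

/-- The canonical map from a lattice to its localization at `p`. -/
noncomputable def toLocalized (p : ℕ) [Fact p.Prime] (M : GLattice G) :
    M.carrier →+ LocalizedModule (compl p) M.carrier :=
  (LocalizedModule.mkLinearMap (compl p) M.carrier).toAddMonoidHom

theorem toLocalized_smul (M : GLattice G) (n : ℤ) (x : M.carrier) :
    toLocalized p M (n • x) = algebraMap ℤ (Localization (compl p)) n • toLocalized p M x :=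
  LocalizedModule.mkLinearMap_smul _ n x

theorem toLocalized_injective (M : GLattice G) : Function.Injective (toLocalized p M) :=
  LocalizedModule.mkLinearMap_injective _ compl_le_nonZeroDivisors

theorem localize_toLocalized (M : GLattice G) (g : G) (x : M.carrier) :
    M.localize p g (toLocalized p M x) = toLocalized p M (M.ρ g x) :=
  LocalizedModule.map_mk _ _ _ _

/-- A linear map between localized lattices is, up to a denominator, defined on the lattices. -/
theorem exists_intertwiningMap_of_localize {M N : GLattice G}
    (f : (M.localize p).IntertwiningMap (N.localize p)) :
    ∃ (g : M.ρ.IntertwiningMap N.ρ) (s : ℤ), ¬ (p : ℤ) ∣ s ∧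
      ∀ x, toLocalized p N (g x) =
        algebraMap ℤ (Localization (compl p)) s • f (toLocalized p M x) := by
  have := Module.finitePresentation_of_finite ℤ M.carrier
  obtain ⟨h, s, hs⟩ :=
    LocalizedModule.exists_linearMap_of_finitePresentation (compl p) f.toLinearMap
  have hs' : ∀ x, toLocalized p N (h x) =
      algebraMap ℤ (Localization (compl p)) s • f (toLocalized p M x) := hs
  -- Equivariance can be tested in the localization, since a lattice embeds in it.
  refine ⟨⟨h, fun g => LinearMap.ext fun x => toLocalized_injective (p := p) N ?_⟩, s,
    mem_compl_iff.mp s.2, hs'⟩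
  simp only [LinearMap.comp_apply]
  rw [hs', ← localize_toLocalized, ← localize_toLocalized, hs', map_smul, f.isIntertwining]

theorem IsPInvertible.exists_integral {M : GLattice G} (hM : M.IsPInvertible p) :
    ∃ P : GLattice G, P.IsPermutation ∧
      ∃ (i : M.ρ.IntertwiningMap P.ρ) (r : P.ρ.IntertwiningMap M.ρ) (s : ℤ), ¬ (p : ℤ) ∣ s ∧
        ∀ x, r (i x) = s • x := by
  obtain ⟨P, hP, i, r, hir⟩ := hM
  obtain ⟨i', s, hs, hi⟩ := exists_intertwiningMap_of_localize i
  obtain ⟨r', t, ht, hr⟩ := exists_intertwiningMap_of_localize r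
  refine ⟨P, hP, i', r', t * s, fun h => ?_, fun x => toLocalized_injective (p := p) M ?_⟩
  · exact ((Nat.prime_iff_prime_int.mp Fact.out).dvd_or_dvd h).elim ht hs
  · rw [hr, hi, map_smul r, hir, mul_smul, toLocalized_smul, toLocalized_smul]

theorem IsPermutation.prod {P Q : GLattice G} (hP : P.IsPermutation) (hQ : Q.IsPermutation) :
    IsPermutation ⟨P.carrier × Q.carrier, P.ρ.prod Q.ρ⟩ := by
  obtain ⟨X, b, hb⟩ := hP
  obtain ⟨Y, c, hc⟩ := hQ
  refine ⟨X ⊕ Y, b.prod c, fun g => ?_⟩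
  rintro (x | y)
  · obtain ⟨x', h⟩ := hb g x
    exact ⟨Sum.inl x', by simp [h]⟩
  · obtain ⟨y', h⟩ := hc g y
    exact ⟨Sum.inr y', by simp [h]⟩

/-- A lattice stably equivalent to a `p`-invertible one is, up to an integer prime to `p`, a direct
summand of a permutation lattice. -/
theorem IsPInvertible.exists_integral_of_stablyEquivalent {M N : GLattice G}
    (hM : M.IsPInvertible p) (h : M.StablyEquivalent N) :
    ∃ P : GLattice G, P.IsPermutation ∧
      ∃ (i : N.ρ.IntertwiningMap P.ρ) (r : P.ρ.IntertwiningMap N.ρ) (s : ℤ), ¬ (p : ℤ) ∣ s ∧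
        ∀ x, r (i x) = s • x := by
  obtain ⟨P, Q, hP, hQ, ⟨e⟩⟩ := h
  obtain ⟨P', hP', i, r, s, hs, hir⟩ := hM.exists_integral
  let i₁ : (M.ρ.prod P.ρ).IntertwiningMap (P'.ρ.prod P.ρ) :=
    (i.comp (.fst _ _ _)).prod (.snd _ _ _)
  -- The factor `s` on the second component makes `r₁ ∘ i₁` multiplication by `s` on the whole sum.
  let r₁ : (P'.ρ.prod P.ρ).IntertwiningMap (M.ρ.prod P.ρ) :=
    (r.comp (.fst _ _ _)).prod (s • .snd _ _ _)
  have h₁ : ∀ x, r₁ (i₁ x) = s • x := fun x => Prod.ext (hir x.1) rfl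
  refine ⟨_, hP'.prod hP, i₁.comp (e.symm.toIntertwiningMap.comp (.inl _ _ _)),
    (Representation.IntertwiningMap.fst _ _ _).comp (e.toIntertwiningMap.comp r₁), s, hs,
    fun x => ?_⟩
  change (e (r₁ (i₁ (e.symm (x, 0))))).1 = s • x
  rw [h₁, map_smul]
  have : e (e.symm (x, 0)) = (x, 0) := e.toLinearEquiv.apply_symm_apply _
  rw [this]
  rfl

end

end GLattice

/-! ### The obstruction in `J_G` for noncyclic Sylow subgroups -/

/-- The indicator function of a set of representatives of the cosets `H a` works. It expresses that
functions on `G` are free over `H`. -/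
theorem Subgroup.exists_sum_mul_eq_one {G : Type*} [Group G] (H : Subgroup G) [Fintype H] :
    ∃ d : G → ℤ, ∀ a, ∑ h : H, d (h * a) = 1 := by
  classical
  let rep : G → G := fun a => (Quotient.mk (QuotientGroup.rightRel H) a).out
  have hrep : ∀ (h : H) a, rep (h * a) = rep a := fun h a =>
    congrArg Quotient.out (Quotient.sound (QuotientGroup.rightRel_apply.mpr (by simp)))
  have hmem : ∀ a, rep a * a⁻¹ ∈ H := fun a =>
    QuotientGroup.rightRel_apply.mp (Quotient.exact (Quotient.out_eq
      (Quotient.mk (QuotientGroup.rightRel H) a)).symm)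
  refine ⟨fun a => if rep a = a then 1 else 0, fun a => ?_⟩
  simp only [hrep]
  rw [Finset.sum_eq_single ⟨_, hmem a⟩]
  · simp
  · intro h _ hh
    rw [if_neg]
    intro h'
    exact hh (Subtype.ext (by simp [h']))
  · simp

/-- If `m` kills the group `H`, then it kills the first cohomology of `H` with values in functions
on an `H`-set. -/
theorem exists_nsmul_eq_coboundary {H X T : Type*} [Group H] [MulAction H X] [AddCommGroup T]
    {m : ℕ} (hm : ∀ h : H, h ^ m = 1) (c : H → X → T)
    (hc : ∀ g h x, c (g * h) x = c g x + c h (g⁻¹ • x)) :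
    ∃ b : X → T, ∀ g x, m • c g x = b (g⁻¹ • x) - b x := by
  let rep : X → X := fun x => (Quotient.mk (MulAction.orbitRel H X) x).out
  have hrep : ∀ (g : H) x, rep (g • x) = rep x := fun g x =>
    congrArg Quotient.out (Quotient.sound (MulAction.orbitRel_apply.mpr ⟨g, rfl⟩))
  have hmem : ∀ x, ∃ g : H, g • rep x = x := fun x =>
    MulAction.orbitRel_apply.mp (Quotient.exact (Quotient.out_eq
      (Quotient.mk (MulAction.orbitRel H X) x)).symm)
  choose t ht using hmem
  have h1 : ∀ x, c 1 x = 0 := fun x => by simpa using hc 1 1 x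
  -- At a point `x`, the cocycle restricts to a homomorphism on the stabilizer, which is therefore
  -- killed by `m`.
  have hstab : ∀ (s : H) (x : X), s • x = x → m • c s x = 0 := by
    intro s x hs
    have hs' : s⁻¹ • x = x := by rw [inv_smul_eq_iff, hs]
    have : ∀ k : ℕ, c (s ^ k) x = k • c s x := by
      intro k
      induction k with
      | zero => simp [h1]
      | succ k ih => rw [pow_succ', hc, hs', ih, succ_nsmul']
    rw [← this, hm, h1]
  refine ⟨fun x => -(m • c (t x) x), fun g x => ?_⟩
  -- `g * t (g⁻¹ • x)` and `t x` both carry `rep x` to `x`, so they differ by an element of the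
  -- stabilizer, whose contribution dies after multiplication by `m`.
  have hs : ((t x)⁻¹ * (g * t (g⁻¹ • x))) • rep x = rep x := by
    have := ht (g⁻¹ • x)
    rw [hrep] at this
    rw [mul_smul, mul_smul, this, smul_inv_smul, inv_smul_eq_iff, ht]
  have e1 := hc (t x) ((t x)⁻¹ * (g * t (g⁻¹ • x))) x
  rw [mul_inv_cancel_left, hc, inv_smul_eq_iff.mpr (ht x).symm] at e1
  have e2 := congrArg (m • ·) e1
  simp only [smul_add, hstab _ _ hs, add_zero] at e2
  change m • c g x = -(m • c (t (g⁻¹ • x)) (g⁻¹ • x)) - -(m • c (t x) x)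
  rw [eq_sub_of_add_eq e2, sub_neg_eq_add, neg_add_eq_sub]

namespace GLattice

section

variable {G : Type} [Group G]

theorem IsPermutation.exists_mulAction {P : GLattice G} (hP : P.IsPermutation) :
    ∃ (X : Type) (b : Module.Basis X ℤ P.carrier) (_ : MulAction G X),
      ∀ (g : G) (x : X), P.ρ g (b x) = b (g • x) := by
  obtain ⟨X, b, hb⟩ := hP
  choose f hf using hb
  exact ⟨X, b,
    { smul := f
      one_smul := fun x => b.injective (by change b (f 1 x) = _; rw [← hf]; simp)
      mul_smul := fun g h x => b.injective (by
        change b (f (g * h) x) = b (f g (f h x)); rw [← hf, ← hf, ← hf]; simp) }, hf⟩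

/-- If `F` is a direct summand of a permutation lattice up to the integer `s`, and `m` kills `H`,
then `m * s` kills the first cohomology of `H` with values in the linear maps from `F` to an abelian
group. -/
theorem exists_nsmul_zsmul_eq_coboundary {F P : GLattice G} (hP : P.IsPermutation)
    (i : F.ρ.IntertwiningMap P.ρ) (r : P.ρ.IntertwiningMap F.ρ) {s : ℤ} (hir : ∀ x, r (i x) = s • x)
    {H : Subgroup G} {m : ℕ} (hm : ∀ h : H, h ^ m = 1) {T : Type} [AddCommGroup T]
    (c : H → F.carrier →ₗ[ℤ] T)
    (hc : ∀ (g h : H) y, c (g * h) y = c g y + c h (F.ρ (g⁻¹ : H) y)) :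
    ∃ B : F.carrier →ₗ[ℤ] T, ∀ (g : H) y, m • s • c g y = B (F.ρ (g⁻¹ : H) y) - B y := by
  obtain ⟨X, b, _, hb⟩ := hP.exists_mulAction
  obtain ⟨β, hβ⟩ := exists_nsmul_eq_coboundary hm (fun g x => c g (r (b x))) (fun g h x => by
    change c (g * h) (r (b x)) = c g (r (b x)) + c h (r (b ((g⁻¹ : H) • x)))
    rw [hc, ← r.isIntertwining, hb]
    rfl)
  have key : ∀ (g : H) v, m • c g (r v) =
      b.constr ℤ β (P.ρ (g⁻¹ : H) v) - b.constr ℤ β v := fun g v => by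
    have : m • (c g ∘ₗ r.toLinearMap) =
        b.constr ℤ β ∘ₗ P.ρ (g⁻¹ : H) - b.constr ℤ β := b.ext fun x => by
      change m • c g (r (b x)) =
        b.constr ℤ β (P.ρ (g⁻¹ : H) (b x)) - b.constr ℤ β (b x)
      rw [hb, Module.Basis.constr_basis, Module.Basis.constr_basis]
      exact hβ g x
    exact LinearMap.congr_fun this v
  refine ⟨b.constr ℤ β ∘ₗ i.toLinearMap, fun g y => ?_⟩
  have := key g (i y)
  rw [hir, map_zsmul, ← i.isIntertwining] at this
  exact this

end

section

variable {G : Type} [Group G] [Finite G]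

omit [Finite G] in
theorem augmentation_apply [Fintype G] (v : MonoidAlgebra ℤ G) :
    augmentation G v = ∑ a, v.coeff a := by
  induction v using MonoidAlgebra.induction_linear with
  | zero => simp
  | add x y hx hy => simp [hx, hy, Finset.sum_add_distrib]
  | single g n =>
    classical
    have : MonoidAlgebra.single g n = n • MonoidAlgebra.single g (1 : ℤ) := by simp
    rw [this, map_smul, augmentation, Representation.leftRegularMapEquiv_symm_single]
    simp [Finsupp.single_apply]

/-- The coefficients of an element of the augmentation ideal. -/
noncomputable def augCoeff : (augIdeal G).carrier →ₗ[ℤ] G → ℤ where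
  toFun v := v.1.coeff
  map_add' _ _ := rfl
  map_smul' _ _ := rfl

theorem augCoeff_injective : Function.Injective (augCoeff (G := G)) := fun _ _ h =>
  Subtype.ext (MonoidAlgebra.coeff_injective (DFunLike.coe_injective h))

theorem augCoeff_ρ (g : G) (v : (augIdeal G).carrier) (a : G) :
    augCoeff ((augIdeal G).ρ g v) a = augCoeff v (g⁻¹ * a) :=
  Representation.coeff_ofMulAction g v.1 a

theorem sum_augCoeff [Fintype G] (v : (augIdeal G).carrier) : ∑ a, augCoeff v a = 0 :=
  (augmentation_apply v.1).symm.trans v.2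

theorem exists_augCoeff_eq [Fintype G] (w : G → ℤ) (hw : ∑ a, w a = 0) :
    ∃ v : (augIdeal G).carrier, augCoeff v = w := by
  refine ⟨⟨.ofCoeff (Finsupp.equivFunOnFinite.symm w), ?_⟩, rfl⟩
  exact (augmentation_apply _).trans hw

/-- The coordinate at `a`, as an element of `J_G`. -/
noncomputable def coordJG (a : G) : (JG G).carrier :=
  LinearMap.proj a ∘ₗ augCoeff

/-- The elements of `J_G` as linear forms on `I_G`. -/
noncomputable def evalJG : (JG G).carrier →ₗ[ℤ] (augIdeal G).carrier →ₗ[ℤ] ℤ :=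
  LinearMap.id

theorem evalJG_ρ (g : G) (f : (JG G).carrier) (v : (augIdeal G).carrier) :
    evalJG ((JG G).ρ g f) v = evalJG f ((augIdeal G).ρ g⁻¹ v) :=
  rfl

theorem JG_ρ_coordJG (g a : G) : (JG G).ρ g (coordJG a) = coordJG (g * a) :=
  LinearMap.ext fun v => (augCoeff_ρ g⁻¹ v a).trans (by rw [inv_inv]; rfl)

theorem sum_coordJG [Fintype G] : ∑ a : G, coordJG a = 0 :=
  LinearMap.ext fun v => by
    refine (LinearMap.sum_apply _ _ _).trans (sum_augCoeff v)

/-- If the last term of an exact sequence `0 → J_G → P → F → 0` with `P` permutation is a direct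
summand of a permutation lattice up to the integer `s`, and `m` kills the subgroup `H`, then the
order of `H` divides `m * s`. -/
theorem natCard_dvd_mul {P F P' : GLattice G} (hP : P.IsPermutation) (hP' : P'.IsPermutation)
    (i : (JG G).ρ.IntertwiningMap P.ρ) (q : P.ρ.IntertwiningMap F.ρ) (hi : Function.Injective i)
    (hiq : Function.Exact i q) (hq : Function.Surjective q)
    (i' : F.ρ.IntertwiningMap P'.ρ) (r : P'.ρ.IntertwiningMap F.ρ) {s : ℤ}
    (hir : ∀ x, r (i' x) = s • x) (H : Subgroup G) {m : ℕ} (hm : ∀ h : H, h ^ m = 1) :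
    (Nat.card H : ℤ) ∣ m * s := by
  classical
  have := Fintype.ofFinite G
  set N := Nat.card H with hN
  let red : ℤ →ₗ[ℤ] ZMod N := (Int.castAddHom (ZMod N)).toIntLinearMap
  have hred : ∀ z : ℤ, red z = (z : ZMod N) := fun z => rfl
  obtain ⟨σ, hσ⟩ := Module.projective_lifting_property q.toLinearMap LinearMap.id hq
  have hσ' : ∀ y, q (σ y) = y := LinearMap.congr_fun hσ
  obtain ⟨ρ₀, hρ₀⟩ := ((Function.Exact.split_tfae (f := i.toLinearMap) (g := q.toLinearMap)
    hiq hi hq).out 0 1 rfl rfl).mp ⟨σ, hσ⟩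
  have hρ₀' : ∀ f, ρ₀ (i f) = f := LinearMap.congr_fun hρ₀
  -- `u = ∑_{h ∈ H} h - N · 1`, which is `H`-invariant modulo `N`: `h u = u + N (1 - h)`.
  obtain ⟨u, hu⟩ := exists_augCoeff_eq (G := G)
    (fun a => (if a ∈ H then 1 else 0) - if a = 1 then (N : ℤ) else 0) (by
      rw [Finset.sum_sub_distrib, Finset.sum_boole]
      simp [hN, Nat.card_eq_fintype_card, Fintype.card_subtype])
  let lam : P.carrier →ₗ[ℤ] ZMod N := red ∘ₗ (evalJG.flip u) ∘ₗ ρ₀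
  have hlam' : ∀ f, lam (i f) = red (evalJG f u) := fun f => by
    change red (evalJG (ρ₀ (i f)) u) = _
    rw [hρ₀']
  have hlam : ∀ (h : H) f, lam (P.ρ (h⁻¹ : H) (i f)) = lam (i f) := by
    intro h f
    obtain ⟨w, hw⟩ := exists_augCoeff_eq (G := G)
      (fun a => (if a = 1 then 1 else 0) - if (h : G)⁻¹ * a = 1 then 1 else 0) (by
        simp [Finset.sum_sub_distrib, inv_mul_eq_one])
    have huw : (augIdeal G).ρ (h : G) u = u + (N : ℤ) • w := augCoeff_injective <| by
      funext a
      rw [augCoeff_ρ, map_add, map_zsmul, Pi.add_apply, Pi.smul_apply, hu, hw, smul_eq_mul]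
      simp only [H.mul_mem_cancel_left (H.inv_mem h.2)]
      split_ifs <;> ring
    rw [← i.isIntertwining, hlam', hlam', evalJG_ρ, Subgroup.coe_inv, inv_inv, huw, map_add,
      map_zsmul, map_add, map_zsmul, zsmul_eq_mul]
    simp
  -- The defect of invariance of `lam` vanishes on the image of `J_G`, so it descends to a cocycle
  -- on `F` that does not depend on the section `σ`.
  let c : H → F.carrier →ₗ[ℤ] ZMod N := fun h => (lam ∘ₗ P.ρ (h⁻¹ : H) - lam) ∘ₗ σ
  have hcq : ∀ (h : H) v, c h (q v) = lam (P.ρ (h⁻¹ : H) v) - lam v := by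
    intro h v
    obtain ⟨f, hf⟩ := (hiq (σ (q v) - v)).mp (by rw [map_sub, hσ', sub_self])
    have : σ (q v) = i f + v := by rw [hf]; abel
    change lam (P.ρ (h⁻¹ : H) (σ (q v))) - lam (σ (q v)) = _
    rw [this, map_add, map_add, map_add, hlam]
    abel
  obtain ⟨B, hB⟩ := exists_nsmul_zsmul_eq_coboundary hP' i' r hir hm c (fun g h y => by
    obtain ⟨v, rfl⟩ := hq y
    rw [← q.isIntertwining, hcq, hcq, hcq, mul_inv_rev, Subgroup.coe_mul, map_mul]
    simp)
  obtain ⟨X, b, _, hb⟩ := hP.exists_mulAction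
  -- Subtracting `B ∘ q` removes the coboundary and leaves the values on the image of `J_G`
  -- unchanged.
  let μ : P.carrier →ₗ[ℤ] ZMod N := m • s • lam - B ∘ₗ q.toLinearMap
  have hμ : ∀ (h : H) v, μ (P.ρ (h : G) v) = μ v := by
    intro h v
    have := hB h⁻¹ (q v)
    rw [hcq, ← q.isIntertwining, inv_inv, smul_sub, smul_sub] at this
    change m • s • lam _ - B (q _) = m • s • lam _ - B (q _)
    rw [sub_eq_sub_iff_sub_eq_sub, this]
  -- `ZMod.cast` is not additive, but it is applied only to values on the permuted basis; these are
  -- constant on `H`-orbits, so the lift stays invariant.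
  let κ : P.carrier →ₗ[ℤ] ℤ := b.constr ℤ fun x => (μ (b x)).cast
  have hκ : ∀ (h : H) v, κ (P.ρ (h : G) v) = κ v := by
    intro h v
    have : κ ∘ₗ P.ρ (h : G) = κ := b.ext fun x => by
      change κ (P.ρ (h : G) (b x)) = κ (b x)
      have e := hμ h (b x)
      rw [hb] at e ⊢
      simp only [κ, Module.Basis.constr_basis, e]
    exact LinearMap.congr_fun this v
  have hκμ : ∀ v, red (κ v) = μ v := by
    intro v
    have : red ∘ₗ κ = μ := b.ext fun x => by
      change red (κ (b x)) = μ (b x)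
      simp only [κ, Module.Basis.constr_basis]
      rw [hred, ZMod.intCast_zmod_cast]
    exact LinearMap.congr_fun this v
  obtain ⟨d, hd⟩ := H.exists_sum_mul_eq_one
  let k : G → ℤ := fun a => κ (i (coordJG a))
  have hk : ∀ (h : H) a, k (h * a) = k a := fun h a => by
    simp only [k]
    rw [← JG_ρ_coordJG, i.isIntertwining, hκ]
  have hk0 : ∑ a, k a = 0 := by
    simp only [k]
    rw [← map_sum, ← map_sum, sum_coordJG, map_zero, map_zero]
  -- `k` is constant on the cosets `H a`, so its sum over `G` is the order of `H` times the
  -- `d`-weighted sum.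
  have hdk : ∑ a, d a * k a = 0 := by
    have e : ∑ a, k a = Fintype.card H • ∑ a, d a * k a := by
      calc ∑ a, k a = ∑ a, ∑ h : H, d (h * a) * k (h * a) := by
            refine Finset.sum_congr rfl fun a _ => ?_
            simp only [hk]
            rw [← Finset.sum_mul, hd, one_mul]
        _ = ∑ h : H, ∑ a, d (h * a) * k (h * a) := Finset.sum_comm
        _ = ∑ h : H, ∑ a, d a * k a :=
            Finset.sum_congr rfl fun h _ =>
              Fintype.sum_equiv (Equiv.mulLeft (h : G)) _ _ fun a => rfl
        _ = _ := by simp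
    rw [hk0] at e
    simpa using e.symm
  have hkN : ∀ a, (k a : ZMod N) = m * s * (if a ∈ H then 1 else 0) := by
    intro a
    have e : evalJG (coordJG a) u = augCoeff u a := rfl
    rw [← hred, hκμ]
    change m • s • lam (i _) - B (q (i _)) = _
    rw [(hiq _).mpr ⟨_, rfl⟩, map_zero, sub_zero, hlam', e, hu, hred]
    simp
  -- Modulo `N`, `k` is `m * s` on `H` and `0` elsewhere, while `d` has sum `1` over `H`.
  have : ((m * s : ℤ) : ZMod N) = 0 := by
    calc ((m * s : ℤ) : ZMod N) = m * s * ((∑ h : H, d h : ℤ) : ZMod N) := by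
          have := hd 1
          simp only [mul_one] at this
          rw [this]
          push_cast
          ring
      _ = m * s * ((∑ a, if a ∈ H then d a else 0 : ℤ) : ZMod N) := by
          rw [← Finset.sum_filter, Finset.sum_subtype (p := fun a => a ∈ H) _ (by simp)]
      _ = ((∑ a, d a * k a : ℤ) : ZMod N) := by
          rw [Int.cast_sum, Int.cast_sum, Finset.mul_sum]
          refine Finset.sum_congr rfl fun a _ => ?_
          rw [Int.cast_mul, hkN]
          split_ifs <;> simp [mul_comm]
      _ = 0 := by rw [hdk, Int.cast_zero]
  exact (ZMod.intCast_zmod_eq_zero_iff_dvd _ _).mp this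

/-- If `[J_G]^fl` is `p`-invertible, then the `p`-Sylow subgroups of `G` are cyclic. -/
theorem FlasqueClassIsPInvertible.isCyclic {p : ℕ} [Fact p.Prime]
    (h : (JG G).FlasqueClassIsPInvertible p) (Gp : Sylow p G) : IsCyclic Gp := by
  obtain ⟨F', ⟨F, ⟨-, P, i, q, hP, hi, hiq, hq⟩, hst⟩, hF'⟩ := h
  obtain ⟨P', hP', i', r, s, hs, hir⟩ := hF'.exists_integral_of_stablyEquivalent hst
  obtain ⟨n, hn⟩ := IsPGroup.iff_card.mp Gp.isPGroup'
  have hp : p.Prime := Fact.out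
  by_contra hcyc
  -- No element has order `p ^ n`, since it would generate.
  have hord : ∀ g : Gp, g ^ p ^ (n - 1) = 1 := by
    intro g
    obtain ⟨k, hk, hgk⟩ := (Nat.dvd_prime_pow hp).mp (hn ▸ orderOf_dvd_natCard g)
    have hkn : k ≠ n := fun e =>
      hcyc (isCyclic_of_orderOf_eq_card g (by rw [hgk, e]; exact hn.symm))
    exact orderOf_dvd_iff_pow_eq_one.mp (hgk ▸ pow_dvd_pow p (by omega))
  have hn0 : n ≠ 0 := by
    rintro rfl
    have : Subsingleton Gp := (Nat.card_eq_one_iff_unique.mp (by simpa using hn)).1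
    exact hcyc inferInstance
  have hdvd := natCard_dvd_mul hP hP' i q hi hiq hq i' r hir (Gp : Subgroup G) hord
  have hn' : Nat.card (Gp : Subgroup G) = p ^ (n - 1) * p := by
    rw [← pow_succ, Nat.sub_add_cancel (Nat.one_le_iff_ne_zero.mpr hn0)]
    exact hn
  rw [hn', Nat.cast_mul] at hdvd
  exact hs (Int.dvd_of_mul_dvd_mul_left (by exact_mod_cast (pow_pos hp.pos _).ne') hdvd)

end

end GLattice

/-! ### A flasque resolution of `J_G` -/

namespace GLattice

section

variable {G : Type} [Group G]

/-- The permutation lattice of integer functions on a finite `G`-set. -/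
def funLattice (G X : Type) [Group G] [Finite X] [MulAction G X] : GLattice G where
  carrier := X → ℤ
  ρ :=
    { toFun := fun g => LinearMap.funLeft ℤ ℤ (g⁻¹ • ·)
      map_one' := by ext; simp [LinearMap.funLeft]
      map_mul' := fun g h => by ext; simp [LinearMap.funLeft, mul_smul] }

theorem exists_basis_funLattice (X : Type) [Finite X] [MulAction G X] :
    ∃ b : Module.Basis X ℤ (funLattice G X).carrier,
      ∀ g x, (funLattice G X).ρ g (b x) = b (g • x) := by
  classical
  refine ⟨Pi.basisFun ℤ X, fun g x => funext fun y => ?_⟩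
  change (Pi.basisFun ℤ X x) (g⁻¹ • y) = Pi.basisFun ℤ X (g • x) y
  simp [Pi.single_apply, inv_smul_eq_iff]

theorem isPermutation_funLattice (X : Type) [Finite X] [MulAction G X] :
    (funLattice G X).IsPermutation :=
  let ⟨b, hb⟩ := exists_basis_funLattice (G := G) X
  ⟨X, b, fun g x => ⟨g • x, hb g x⟩⟩

/-- The lattice map between function lattices given by an equivariant linear map. -/
def funLattice.map {X Y : Type} [Finite X] [Finite Y] [MulAction G X] [MulAction G Y]
    (f : (X → ℤ) →ₗ[ℤ] Y → ℤ) (hf : ∀ (g : G) φ y, f (fun x => φ (g⁻¹ • x)) y = f φ (g⁻¹ • y)) :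
    (funLattice G X).ρ.IntertwiningMap (funLattice G Y).ρ :=
  ⟨f, fun g => LinearMap.ext fun φ => funext fun y => hf g φ y⟩

/-- The lattice of functions `φ(a,b) + φ(b,c) - φ(a,c)`. -/
def cocycleDifferential [Finite G] :
    (funLattice G (G × G)).ρ.IntertwiningMap (funLattice G (G × G × G)).ρ :=
  funLattice.map
    { toFun := fun φ x => φ (x.1, x.2.1) + φ (x.2.1, x.2.2) - φ (x.1, x.2.2)
      map_add' := fun φ ψ => funext fun x => by simp only [Pi.add_apply]; ring
      map_smul' := fun n φ => funext fun x => by simp; ring }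
    fun _ _ _ => rfl

end

section

variable {G : Type} [Group G] [Finite G]

/-- The element `[b] - [a]` of the augmentation ideal. -/
noncomputable def diffAug (x : G × G) : (augIdeal G).carrier :=
  ⟨.single x.2 1 - .single x.1 1, by
    change augmentation G _ = 0
    rw [augmentation, map_sub, Representation.leftRegularMapEquiv_symm_single,
      Representation.leftRegularMapEquiv_symm_single]
    simp⟩

theorem augCoeff_diffAug [DecidableEq G] (x : G × G) :
    augCoeff (diffAug x) = Pi.single x.2 1 - Pi.single x.1 1 := by
  refine funext fun a => ?_
  change (MonoidAlgebra.single x.2 (1 : ℤ) - .single x.1 1).coeff a = _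
  simp [Finsupp.single_apply, Pi.single_apply, eq_comm]

theorem ρ_diffAug (g : G) (x : G × G) : (augIdeal G).ρ g (diffAug x) = diffAug (g • x) := by
  classical
  refine augCoeff_injective (funext fun a => ?_)
  rw [augCoeff_ρ, augCoeff_diffAug, augCoeff_diffAug]
  simp [Pi.single_apply, inv_mul_eq_iff_eq_mul]

theorem diffAug_add (a b c : G) : diffAug (a, b) + diffAug (b, c) = diffAug (a, c) := by
  classical
  refine augCoeff_injective ?_
  rw [map_add, augCoeff_diffAug, augCoeff_diffAug, augCoeff_diffAug]
  simp

theorem eq_sum_diffAug [Fintype G] (v : (augIdeal G).carrier) :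
    v = ∑ a, augCoeff v a • diffAug (1, a) := by
  classical
  refine augCoeff_injective (funext fun b => ?_)
  rw [map_sum, Finset.sum_apply]
  simp only [map_zsmul, Pi.smul_apply, augCoeff_diffAug, Pi.sub_apply, smul_eq_mul, mul_sub,
    Finset.sum_sub_distrib, ← Finset.sum_mul, sum_augCoeff]
  simp [Pi.single_apply]

/-- The embedding of `J_G` into a permutation lattice, `f ↦ ((a, b) ↦ f ([b] - [a]))`. -/
noncomputable def embJG : (JG G).ρ.IntertwiningMap (funLattice G (G × G)).ρ where
  toFun f := fun x => evalJG f (diffAug x)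
  map_add' _ _ := rfl
  map_smul' _ _ := rfl
  isIntertwining' g := LinearMap.ext fun f => funext fun x => by
    change evalJG ((JG G).ρ g f) (diffAug x) = evalJG f (diffAug (g⁻¹ • x))
    rw [evalJG_ρ, ρ_diffAug]

theorem embJG_apply (f : (JG G).carrier) (x : G × G) : embJG f x = evalJG f (diffAug x) := rfl

theorem embJG_injective : Function.Injective (embJG (G := G)) := fun f f' h => by
  have := Fintype.ofFinite G
  refine LinearMap.ext (f := evalJG f) (g := evalJG f') fun v => ?_
  rw [eq_sum_diffAug v, map_sum, map_sum]
  refine Finset.sum_congr rfl fun a _ => ?_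
  rw [map_zsmul, map_zsmul]
  exact congrArg _ (congrFun h (1, a))

/-- The element of `J_G` with `[b] - [a] ↦ w b - w a`. -/
noncomputable def ofFunJG [Fintype G] (w : G → ℤ) : (JG G).carrier :=
  Fintype.linearCombination ℤ w ∘ₗ augCoeff

theorem embJG_ofFunJG [Fintype G] (w : G → ℤ) (x : G × G) :
    embJG (ofFunJG w) x = w x.2 - w x.1 := by
  classical
  change Fintype.linearCombination ℤ w (augCoeff (diffAug x)) = _
  rw [augCoeff_diffAug, map_sub]
  simp [Fintype.linearCombination_apply_single]

theorem exact_embJG : Function.Exact (embJG (G := G)) (cocycleDifferential (G := G)) := by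
  have := Fintype.ofFinite G
  intro φ
  constructor
  · intro h
    refine ⟨ofFunJG fun a => φ (1, a), funext fun x => ?_⟩
    rw [embJG_ofFunJG]
    have : φ (1, x.1) + φ (x.1, x.2) - φ (1, x.2) = 0 := congrFun h (1, x.1, x.2)
    linarith
  · rintro ⟨f, rfl⟩
    refine funext fun x => ?_
    change evalJG f (diffAug _) + evalJG f (diffAug _) - evalJG f (diffAug _) = 0
    rw [← map_add, diffAug_add, sub_self]

omit [Finite G] in
-- This is `Ĥ⁻¹(H, ℤ^X) = 0` for a free action, freeness entering through the weight `d`. With `f h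
-- x = d x * φ (h x)`, the translated terms sum to `φ x` because `d` has sum `1` over the orbit, and
-- the others cancel because `φ` has norm zero.
theorem eq_sum_of_sum_eq_zero {X : Type} [Finite X] [MulAction G X] (H : Subgroup G) [Fintype H]
    (d : X → ℤ) (hd : ∀ x, ∑ h : H, d ((h : G) • x) = 1) (φ : (funLattice G X).carrier)
    (hφ : ∑ h : H, (funLattice G X).ρ h φ = 0) :
    ∃ f : H → (funLattice G X).carrier, φ = ∑ h : H, ((funLattice G X).ρ h (f h) - f h) := by
  have hinv : ∀ ψ : G → ℤ, ∑ h : H, ψ ((h : G)⁻¹) = ∑ h : H, ψ h := fun ψ =>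
    Fintype.sum_equiv (Equiv.inv H) _ _ fun h => by simp
  have hsum : ∀ (ψ : H → (funLattice G X).carrier) x, (∑ h, ψ h) x = ∑ h, ψ h x :=
    fun ψ x => Finset.sum_apply x _ _
  refine ⟨fun h x => d x * φ ((h : G) • x), funext fun x => ?_⟩
  have h1 : ∑ h : H, φ ((h : G)⁻¹ • x) = 0 := (hsum _ x).symm.trans (congrFun hφ x)
  rw [hinv fun g => φ (g • x)] at h1
  rw [hsum]
  change φ x = ∑ h : H, (d ((h : G)⁻¹ • x) * φ ((h : G) • (h : G)⁻¹ • x) - d x * φ ((h : G) • x))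
  rw [Finset.sum_sub_distrib, ← Finset.mul_sum, h1, mul_zero, sub_zero]
  simp only [smul_inv_smul]
  rw [← Finset.sum_mul, hinv fun g => d (g • x), hd, one_mul]

/-- Every invariant of a subgroup in `J_G` is a norm. -/
theorem exists_sum_ρ_eq_of_forall_ρ_eq (H : Subgroup G) [Fintype H] (f : (JG G).carrier)
    (hf : ∀ h : H, (JG G).ρ h f = f) : ∃ f', ∑ h : H, (JG G).ρ h f' = f := by
  have := Fintype.ofFinite G
  obtain ⟨d, hd⟩ := H.exists_sum_mul_eq_one
  have hadd : ∀ a b c, embJG f (a, b) + embJG f (b, c) = embJG f (a, c) := fun a b c => by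
    simp only [embJG_apply]
    rw [← map_add, diffAug_add]
  have hone : embJG f (1, 1) = 0 := by simpa using hadd 1 1 1
  have htrans : ∀ (h : H) (a b : G), embJG f (h * a, h * b) = embJG f (a, b) := fun h a b => by
    simp only [embJG_apply]
    conv_rhs => rw [← hf h⁻¹, evalJG_ρ, ρ_diffAug]
    simp
  have hmul : ∀ (h : H) a, embJG f (1, h * a) = embJG f (1, (h : G)) + embJG f (1, a) :=
    fun h a => by
      rw [← hadd 1 h (h * a)]
      nth_rw 2 [← mul_one (h : G)]
      rw [htrans]
  -- By `hmul`, this is a homomorphism from a finite group to `ℤ`.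
  have hzero : ∀ h : H, embJG f (1, (h : G)) = 0 := by
    intro h
    have hpow : ∀ k : ℕ, embJG f (1, (h : G) ^ k) = k * embJG f (1, (h : G)) := by
      intro k
      induction k with
      | zero => simpa using hone
      | succ k ih =>
        rw [pow_succ', hmul, ih]
        push_cast
        ring
    have := hpow (orderOf (h : G))
    rw [pow_orderOf_eq_one, hone, eq_comm, mul_eq_zero] at this
    exact this.resolve_left (by exact_mod_cast (orderOf_pos (h : G)).ne')
  -- Now `a ↦ f ([a] - [1])` is left `H`-invariant, so it is the norm of its product with `d`.
  refine ⟨ofFunJG fun a => d a * embJG f (1, a), embJG_injective (funext fun x => ?_)⟩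
  have hsum : ∀ a, ∑ h : H, d ((h : G)⁻¹ * a) * embJG f (1, (h : G)⁻¹ * a) = embJG f (1, a) := by
    intro a
    have e : ∀ h : H, embJG f (1, (h : G) * a) = embJG f (1, a) := fun h => by
      rw [hmul, hzero, zero_add]
    rw [Fintype.sum_equiv (Equiv.inv H) _
      (fun h : H => d ((h : G) * a) * embJG f (1, (h : G) * a)) (fun h => by simp)]
    simp only [e]
    rw [← Finset.sum_mul, hd, one_mul]
  have hρ : ∀ h : H, embJG ((JG G).ρ h (ofFunJG fun a => d a * embJG f (1, a))) x =
      d ((h : G)⁻¹ * x.2) * embJG f (1, (h : G)⁻¹ * x.2) -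
        d ((h : G)⁻¹ * x.1) * embJG f (1, (h : G)⁻¹ * x.1) := fun h => by
    rw [embJG.isIntertwining]
    exact embJG_ofFunJG _ ((h : G)⁻¹ • x)
  rw [map_sum]
  refine (Finset.sum_apply x _ _).trans ?_
  simp only [hρ]
  rw [Finset.sum_sub_distrib, hsum, hsum, ← hadd 1 x.1 x.2, add_sub_cancel_left]

/-- `J_G` has a flasque resolution. -/
theorem exists_hasFlasqueResolution_JG : ∃ F, (JG G).HasFlasqueResolution F := by
  let q := cocycleDifferential (G := G)
  let F : GLattice G := ⟨q.range.toSubmodule, q.range.toRepresentation⟩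
  let q' : (funLattice G (G × G)).ρ.IntertwiningMap F.ρ :=
    ⟨q.toLinearMap.rangeRestrict, fun g => LinearMap.ext fun φ => Subtype.ext (by
      exact q.isIntertwining _ _ g φ)⟩
  have hq' : Function.Surjective q' := q.toLinearMap.surjective_rangeRestrict
  have hex : Function.Exact (embJG (G := G)) q' := fun φ =>
    (Subtype.ext_iff (a1 := q' φ) (a2 := 0)).trans (exact_embJG φ)
  refine ⟨F, (isFlasque_iff F).mpr fun H _ y hy => ?_, _, embJG, q', isPermutation_funLattice _,
    embJG_injective, hex, hq'⟩
  obtain ⟨φ, rfl⟩ := hq' y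
  -- This is the connecting map `Ĥ⁻¹(H, F) → Ĥ⁰(H, J_G)`: the norm of a lift `φ` is an invariant of
  -- `J_G`, hence the norm of some `f'`. Replacing `φ` by `φ - f'` gives a lift of norm zero.
  obtain ⟨f, hf⟩ := (hex (∑ h : H, (funLattice G (G × G)).ρ h φ)).mp (by
    rw [map_sum, ← hy]
    exact Finset.sum_congr rfl fun h _ => q'.isIntertwining _ _ _ _)
  obtain ⟨f', rfl⟩ := exists_sum_ρ_eq_of_forall_ρ_eq H f fun h => embJG_injective <| by
    rw [embJG.isIntertwining, hf, map_sum]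
    refine Fintype.sum_equiv (Equiv.mulLeft h) _ _ fun k => ?_
    simp
  obtain ⟨d, hd⟩ := H.exists_sum_mul_eq_one
  obtain ⟨ψ, hψ⟩ := eq_sum_of_sum_eq_zero H (fun x : G × G => d x.1) (fun x => hd x.1)
    (φ - embJG f') (by
      simp only [map_sub, Finset.sum_sub_distrib]
      rw [← hf, map_sum, sub_eq_zero]
      exact Finset.sum_congr rfl fun h _ => embJG.isIntertwining _ _ _ _)
  refine ⟨fun h => q' (ψ h), ?_⟩
  have := congrArg q' hψ
  rw [map_sub, (hex _).mpr ⟨f', rfl⟩, sub_zero, map_sum] at this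
  rw [this]
  exact Finset.sum_congr rfl fun h _ => by rw [map_sub, q'.isIntertwining]

theorem stablyEquivalent_refl (M : GLattice G) : M.StablyEquivalent M :=
  ⟨funLattice G G, funLattice G G, isPermutation_funLattice G, isPermutation_funLattice G,
    ⟨.refl _⟩⟩

/-- If all flasque lattices are `p`-invertible, then so is `[J_G]^fl`. -/
theorem flasqueClassIsPInvertible_JG {p : ℕ} [Fact p.Prime]
    (h : ∀ M : GLattice G, M.IsFlasque → M.IsPInvertible p) :
    (JG G).FlasqueClassIsPInvertible p := by
  obtain ⟨F, hF⟩ := exists_hasFlasqueResolution_JG (G := G)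
  exact ⟨F, ⟨F, hF, stablyEquivalent_refl F⟩, h F hF.1⟩

end

end GLattice

/-! ### Cyclotomic extensions of a discrete valuation ring with uniformizer `p` -/

namespace Polynomial

/-- Cyclotomic polynomials of prime power order over a domain in which `p` is prime. -/
theorem prime_cyclotomic_prime_pow {R : Type*} [CommRing R] [IsDomain R]
    [UniqueFactorizationMonoid R] {p : ℕ} [hp : Fact p.Prime] (hpR : Prime (p : R)) (n : ℕ) :
    Prime (cyclotomic (p ^ (n + 1)) R) := by
  rw [← UniqueFactorizationMonoid.irreducible_iff_prime,
    ← MulEquiv.irreducible_iff (algEquivAevalXAddC (1 : R))]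
  have hcomp : algEquivAevalXAddC (1 : R) (cyclotomic (p ^ (n + 1)) R) =
      (cyclotomic (p ^ (n + 1)) R).comp (X + 1) := by
    simp [aeval_def, comp]
  rw [hcomp]
  have hmon : ((cyclotomic (p ^ (n + 1)) R).comp (X + 1)).Monic := by
    rw [show (X + 1 : R[X]) = X + C 1 by simp]
    exact (cyclotomic.monic _ R).comp_X_add_C 1
  have hmap : (cyclotomic (p ^ (n + 1)) R).comp (X + 1) =
      ((cyclotomic (p ^ (n + 1)) ℤ).comp (X + 1)).map (Int.castRingHom R) := by
    simp [Polynomial.map_comp]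
  have hZ := cyclotomic_prime_pow_comp_X_add_one_isEisensteinAt p n
  have hdegZ : ((cyclotomic (p ^ (n + 1)) ℤ).comp (X + 1)).Monic := by
    rw [show (X + 1 : ℤ[X]) = X + C 1 by simp]
    exact (cyclotomic.monic _ ℤ).comp_X_add_C 1
  have hprime : (Ideal.span {(p : R)}).IsPrime :=
    (Ideal.span_singleton_prime hpR.ne_zero).mpr hpR
  -- The Eisenstein divisibilities after `X ↦ X + 1` come from `ℤ`. The constant term is `Φ(1) = p`,
  -- which is not in `(p)²` because `p` is prime in `R`.
  refine (hmon.isEisensteinAt_of_mem_of_notMem (𝓟 := Ideal.span {(p : R)}) hprime.ne_top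
    (fun {i} hi => ?_) ?_).irreducible hprime hmon.isPrimitive ?_
  · rw [hmap, coeff_map, Ideal.mem_span_singleton]
    rw [hmap, hdegZ.natDegree_map] at hi
    have := hZ.mem hi
    rw [Ideal.submodule_span_eq, Ideal.mem_span_singleton] at this
    simpa using (Int.castRingHom R).map_dvd this
  · rw [coeff_zero_eq_eval_zero, eval_comp, eval_add, eval_X, eval_one, zero_add,
      eval_one_cyclotomic_prime_pow, Ideal.span_singleton_pow, Ideal.mem_span_singleton, sq]
    exact fun h => hpR.not_isUnit (isUnit_of_dvd_one
      ((mul_dvd_mul_iff_left hpR.ne_zero).mp (by simpa using h)))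
  · rw [show (X + 1 : R[X]) = X + C 1 by simp, natDegree_comp, natDegree_X_add_C, mul_one,
      natDegree_cyclotomic]
    exact Nat.totient_pos.mpr (pow_pos hp.out.pos _)

end Polynomial

open Polynomial in
/-- The ring obtained from a discrete valuation ring with uniformizer `p` by adjoining a root of
unity of order a power of `p` is a principal ideal domain. -/
theorem isPrincipalIdealRing_adjoinRoot_cyclotomic {R : Type*} [CommRing R] [IsDomain R]
    [IsPrincipalIdealRing R] [IsLocalRing R] {p : ℕ} [hp : Fact p.Prime]
    (hpR : (p : R) ≠ 0) (hmax : IsLocalRing.maximalIdeal R = Ideal.span {(p : R)}) (n : ℕ) :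
    IsDomain (AdjoinRoot (cyclotomic (p ^ (n + 1)) R)) ∧
      IsPrincipalIdealRing (AdjoinRoot (cyclotomic (p ^ (n + 1)) R)) := by
  have hprime : Prime (p : R) := (Ideal.span_singleton_prime hpR).mp (hmax ▸ inferInstance)
  set Φ := cyclotomic (p ^ (n + 1)) R with hΦ
  have hdom : IsDomain (AdjoinRoot Φ) :=
    AdjoinRoot.isDomain_of_prime (prime_cyclotomic_prime_pow hprime n)
  have hmon : Φ.Monic := cyclotomic.monic _ _
  have hfin : Module.Finite R (AdjoinRoot Φ) := hmon.finite_adjoinRoot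
  have hnoeth : IsNoetherianRing (AdjoinRoot Φ) := IsNoetherianRing.of_finite R _
  set ϖ := AdjoinRoot.root Φ - 1 with hϖ
  have hdvd : ∀ f : R[X], ϖ ∣ AdjoinRoot.mk Φ f - algebraMap R _ (f.eval 1) := by
    intro f
    have := map_dvd (AdjoinRoot.mk Φ) (X_sub_C_dvd_sub_C_eval (a := 1) (p := f))
    simpa [hϖ] using this
  have hϖp : ϖ ∣ algebraMap R _ (p : R) := by
    have := hdvd Φ
    have h1 : Φ.eval 1 = p := eval_one_cyclotomic_prime_pow n
    rwa [AdjoinRoot.mk_self, zero_sub, dvd_neg, h1] at this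
  have hpow : AdjoinRoot.root Φ ^ p ^ (n + 1) = 1 := by
    have := map_dvd (AdjoinRoot.mk Φ) (cyclotomic.dvd_X_pow_sub_one (p ^ (n + 1)) R)
    rw [AdjoinRoot.mk_self, zero_dvd_iff] at this
    simpa [sub_eq_zero] using this
  -- By integrality, `m` lies over `(p)`, and `ϖ ^ p ^ (n + 1)` is congruent to `ζ ^ p ^ (n + 1) - 1
  -- = 0` modulo `p`.
  have hϖmem : ∀ m : Ideal (AdjoinRoot Φ), m.IsMaximal → ϖ ∈ m := by
    intro m hm
    have hcomap : m.comap (algebraMap R (AdjoinRoot Φ)) = IsLocalRing.maximalIdeal R :=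
      IsLocalRing.eq_maximalIdeal (Ideal.isMaximal_comap_of_isIntegral_of_isMaximal m)
    have hpm : (p : AdjoinRoot Φ) ∈ m := by
      have : (p : R) ∈ m.comap (algebraMap R (AdjoinRoot Φ)) := by
        rw [hcomap, hmax]
        exact Ideal.mem_span_singleton_self _
      simpa using this
    refine hm.isPrime.mem_of_pow_mem (p ^ (n + 1)) ?_
    obtain ⟨r, hr⟩ := exists_add_pow_prime_pow_eq hp.out ϖ 1 (n + 1)
    rw [hϖ, sub_add_cancel, hpow, one_pow] at hr
    have : (AdjoinRoot.root Φ - 1) ^ p ^ (n + 1) = p * (-(ϖ * 1 * r)) := by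
      linear_combination -hr
    rw [hϖ, this]
    exact m.mul_mem_right _ hpm
  have hϖunit : ¬ IsUnit ϖ := fun h => by
    obtain ⟨m, hm⟩ := Ideal.exists_maximal (AdjoinRoot Φ)
    exact hm.ne_top (m.eq_top_of_isUnit_mem (hϖmem m hm) h)
  -- Modulo `ϖ`, `f(ζ)` equals `f(1)`; this is either a unit of `R` or a multiple of `p`, and `ϖ`
  -- divides `p`. So `ϖ` generates the unique maximal ideal of a Noetherian domain.
  have hor : ∀ a : AdjoinRoot Φ, ¬ IsUnit a → ϖ ∣ a := by
    intro a ha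
    obtain ⟨f, rfl⟩ := AdjoinRoot.mk_surjective a
    by_cases hu : IsUnit (f.eval 1)
    · obtain ⟨m, hm, ham⟩ := exists_max_ideal_of_mem_nonunits ha
      have h1 : algebraMap R (AdjoinRoot Φ) (f.eval 1) ∈ m := by
        have := m.sub_mem ham (m.mem_of_dvd (hdvd f) (hϖmem m hm))
        rwa [sub_sub_cancel] at this
      exact absurd (m.eq_top_of_isUnit_mem h1 (hu.map _)) hm.ne_top
    · have h1 : (p : R) ∣ f.eval 1 := by
        rw [← Ideal.mem_span_singleton, ← hmax]
        exact hu
      exact (dvd_sub_left (hϖp.trans (map_dvd _ h1))).mp (hdvd f)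
  have hloc : IsLocalRing (AdjoinRoot Φ) := IsLocalRing.of_nonunits_add fun a b ha hb h =>
    hϖunit (isUnit_of_dvd_unit (dvd_add (hor a ha) (hor b hb)) h)
  refine ⟨hdom, ((tfae_of_isNoetherianRing_of_isLocalRing_of_isDomain (AdjoinRoot Φ)).out 4 0
    rfl rfl).mp ⟨ϖ, le_antisymm (fun a ha => ?_) ?_⟩⟩
  · exact Ideal.mem_span_singleton.mpr (hor a ha)
  · exact (Ideal.span_singleton_le_iff_mem _).mpr hϖunit

open Polynomial

section Coordinates

variable {R : Type*} [CommRing R] [IsDomain R] [IsPrincipalIdealRing R] [IsLocalRing R] {p : ℕ}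
  [hp : Fact p.Prime]

/-- A torsion-free module with an endomorphism killed by a cyclotomic polynomial of prime power
order has coordinates in the ring generated by a root of that polynomial. -/
theorem exists_coordinates_adjoinRoot_cyclotomic (hpR : (p : R) ≠ 0)
    (hmax : IsLocalRing.maximalIdeal R = Ideal.span {(p : R)}) (n : ℕ)
    {L : Type*} [AddCommGroup L] [Module R L] [Module.Finite R L] [Module.IsTorsionFree R L]
    (σ : L →ₗ[R] L) (hσ : aeval σ (cyclotomic (p ^ (n + 1)) R) = 0) :
    ∃ (r : ℕ) (e : Fin r → L)
      (coord : Fin r → L →ₗ[R] AdjoinRoot (cyclotomic (p ^ (n + 1)) R)),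
      (∀ i x, coord i (σ x) = AdjoinRoot.root _ * coord i x) ∧
      ∀ x (f : Fin r → R[X]), (∀ i, AdjoinRoot.mk _ (f i) = coord i x) →
        x = ∑ i, aeval σ (f i) (e i) := by
  set Φ := cyclotomic (p ^ (n + 1)) R with hΦ
  obtain ⟨_, _⟩ : IsDomain (AdjoinRoot Φ) ∧ IsPrincipalIdealRing (AdjoinRoot Φ) :=
    isPrincipalIdealRing_adjoinRoot_cyclotomic hpR hmax n
  have hmon : Φ.Monic := cyclotomic.monic _ _
  have hfin : Module.Finite R (AdjoinRoot Φ) := hmon.finite_adjoinRoot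
  let φ : AdjoinRoot Φ →+* Module.End R L :=
    Ideal.Quotient.lift (Ideal.span {Φ}) (aeval σ : R[X] →ₐ[R] Module.End R L).toRingHom
      fun a ha => by
        obtain ⟨b, rfl⟩ := Ideal.mem_span_singleton.mp ha
        change aeval σ (Φ * b) = 0
        rw [map_mul, hσ, zero_mul]
  have hφ : ∀ f, φ (AdjoinRoot.mk Φ f) = aeval σ f := fun f => rfl
  let _ : Module (AdjoinRoot Φ) L := Module.compHom L φ
  have hsmul : ∀ (f : R[X]) (x : L), AdjoinRoot.mk Φ f • x = aeval σ f x := fun f x => rfl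
  have : IsScalarTower R (AdjoinRoot Φ) L := IsScalarTower.of_algebraMap_smul fun a x => by
    have := hsmul (C a) x
    rw [AdjoinRoot.mk_C] at this
    simpa using this
  have : Module.Finite (AdjoinRoot Φ) L := Module.Finite.of_restrictScalars_finite R _ _
  -- By integrality, a nonzero `a` divides a nonzero element of `R`, so torsion over `R[ζ]` would be
  -- torsion over `R`.
  have : Module.IsTorsionFree (AdjoinRoot Φ) L := Module.IsTorsionFree.of_smul_eq_zero fun a x h => by
    by_contra! hne
    have hbot := Ideal.comap_ne_bot_of_integral_mem (R := R) (I := Ideal.span {a}) hne.1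
      (Ideal.mem_span_singleton_self a) (Algebra.IsIntegral.isIntegral a)
    obtain ⟨b, hb, hb0⟩ := Submodule.exists_mem_ne_zero_of_ne_bot hbot
    obtain ⟨c, hc⟩ := Ideal.mem_span_singleton.mp (Ideal.mem_comap.mp hb)
    have : b • x = 0 := by
      rw [← algebraMap_smul (AdjoinRoot Φ), hc, mul_comm, mul_smul, h, smul_zero]
    exact (smul_ne_zero hb0 hne.2) this
  let b := Module.finBasis (AdjoinRoot Φ) L
  refine ⟨_, b, fun i => (b.coord i).restrictScalars R, fun i x => ?_, fun x f hf => ?_⟩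
  · have h1 : σ x = AdjoinRoot.root Φ • x := by
      have := hsmul X x
      rw [AdjoinRoot.mk_X, aeval_X] at this
      exact this.symm
    change b.coord i (σ x) = _ * b.coord i x
    rw [h1, map_smul, smul_eq_mul]
  · conv_lhs => rw [← b.sum_repr x]
    refine Finset.sum_congr rfl fun i _ => ?_
    rw [← hsmul, hf]
    rfl

end Coordinates

/-- Indexing powers by `ZMod N` lets sums over the cyclic group be reindexed by translation. -/
theorem pow_zmod_val_add {S : Type*} [Monoid S] {N : ℕ} [NeZero N] {x : S} (hx : x ^ N = 1)
    (a b : ZMod N) : x ^ (a + b).val = x ^ a.val * x ^ b.val := by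
  rw [ZMod.val_add, ← pow_eq_pow_mod _ hx, pow_add]

theorem pow_zmod_val_natCast {S : Type*} [Monoid S] {N : ℕ} {x : S} (hx : x ^ N = 1)
    (m : ℕ) : x ^ (m : ZMod N).val = x ^ m := by
  rw [ZMod.val_natCast, ← pow_eq_pow_mod _ hx]

theorem pow_zmod_val_add_one {S : Type*} [Monoid S] {N : ℕ} [NeZero N] {x : S} (hx : x ^ N = 1)
    (a : ZMod N) : x ^ (a + 1).val = x ^ a.val * x := by
  rw [pow_zmod_val_add hx, ← Nat.cast_one, pow_zmod_val_natCast hx, pow_one]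

section Duality

variable {R : Type*} [CommRing R] {p : ℕ} [hp : Fact p.Prime]

theorem root_cyclotomic_pow_eq_one (N : ℕ) : AdjoinRoot.root (cyclotomic N R) ^ N = 1 := by
  have := map_dvd (AdjoinRoot.mk (cyclotomic N R)) (cyclotomic.dvd_X_pow_sub_one N R)
  rw [AdjoinRoot.mk_self, zero_dvd_iff] at this
  simpa [sub_eq_zero] using this

instance neZero_prime_pow (n : ℕ) : NeZero (p ^ n) := ⟨(pow_pos hp.out.pos n).ne'⟩

/-- The prescription on monomials descends modulo `Φ = ∑_{i < p} X ^ (p ^ n * i)`: on `Φ * X ^ j` it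
telescopes to `u (p ^ (n + 1) + j) - u j = 0`. -/
theorem exists_linearForm_root_pow [Nontrivial R] (n : ℕ) (u : ZMod (p ^ (n + 1)) → R) :
    ∃ t : AdjoinRoot (cyclotomic (p ^ (n + 1)) R) →ₗ[R] R,
      ∀ m : ℕ, t (AdjoinRoot.root _ ^ m) = u ((m + p ^ n : ℕ) : ZMod _) - u (m : ZMod _) := by
  have hmon : (cyclotomic (p ^ (n + 1)) R).Monic := cyclotomic.monic _ _
  have hb : ∀ m, basisMonomials R m = X ^ m := fun m => by simp [monomial_one_right_eq_X_pow]
  obtain ⟨τ, hτ⟩ : ∃ τ : R[X] →ₗ[R] R, ∀ m : ℕ,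
      τ (X ^ m) = u ((m + p ^ n : ℕ) : ZMod _) - u (m : ZMod _) := by
    refine ⟨(basisMonomials R).constr R fun m : ℕ =>
      u ((m + p ^ n : ℕ) : ZMod _) - u (m : ZMod _), fun m => ?_⟩
    rw [← hb, Module.Basis.constr_basis]
  have hτΦ : ∀ f, τ (cyclotomic (p ^ (n + 1)) R * f) = 0 := by
    intro f
    have : τ ∘ₗ LinearMap.mulLeft R (cyclotomic (p ^ (n + 1)) R) = 0 :=
      (basisMonomials R).ext fun j => by
        rw [hb, LinearMap.comp_apply, LinearMap.mulLeft_apply, LinearMap.zero_apply,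
          cyclotomic_prime_pow_eq_geom_sum hp.out, Finset.sum_mul, map_sum]
        obtain ⟨w, hw⟩ : ∃ w : ℕ → R, ∀ i, w i = u ((p ^ n * i + j : ℕ) : ZMod _) :=
          ⟨_, fun i => rfl⟩
        have : ∀ i, τ ((X ^ p ^ n) ^ i * X ^ j) = w (i + 1) - w i := fun i => by
          rw [← pow_mul, ← pow_add, hτ, hw, hw, mul_add, mul_one, add_right_comm]
        rw [Finset.sum_congr rfl fun i _ => this i, Finset.sum_range_sub, hw, hw, ← pow_succ,
          mul_zero, zero_add, Nat.cast_add, ZMod.natCast_self, zero_add, sub_self]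
    exact LinearMap.congr_fun this f
  refine ⟨τ ∘ₗ AdjoinRoot.modByMonicHom hmon, fun m => ?_⟩
  rw [LinearMap.comp_apply, ← AdjoinRoot.mk_X, ← map_pow, AdjoinRoot.modByMonicHom_mk, ← hτ]
  conv_rhs => rw [← modByMonic_add_div (X ^ m) (cyclotomic (p ^ (n + 1)) R), map_add, hτΦ,
    add_zero]

/-- A linear form on `R[ζ]`, where `ζ` is a root of unity of order `p ^ (n + 1)`, through which
multiplication by `ζ ^ (p ^ n) - 1` factors. -/
theorem exists_linearForm_adjoinRoot_cyclotomic [Nontrivial R] (n : ℕ) :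
    ∃ t : AdjoinRoot (cyclotomic (p ^ (n + 1)) R) →ₗ[R] R,
      ∀ a, ∑ y : ZMod (p ^ (n + 1)), t (AdjoinRoot.root _ ^ (-y).val * a) •
        AdjoinRoot.root (cyclotomic (p ^ (n + 1)) R) ^ y.val =
          (AdjoinRoot.root _ ^ p ^ n - 1) * a := by
  have hb : ∀ m, basisMonomials R m = X ^ m := fun m => by simp [monomial_one_right_eq_X_pow]
  set Φ := cyclotomic (p ^ (n + 1)) R with hΦ
  -- With `u` the indicator of `0`, only `y = p ^ n` and `y = 0` contribute to the sum at `a = 1`.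
  -- The sum commutes with multiplication by `ζ`, which settles all `a`.
  obtain ⟨t, ht⟩ : ∃ t : AdjoinRoot Φ →ₗ[R] R, ∀ m : ℕ, t (AdjoinRoot.root Φ ^ m) =
      (if ((m + p ^ n : ℕ) : ZMod (p ^ (n + 1))) = 0 then 1 else 0) -
        if (m : ZMod (p ^ (n + 1))) = 0 then 1 else 0 :=
    exists_linearForm_root_pow n fun z => if z = 0 then 1 else 0
  have hζ : AdjoinRoot.root Φ ^ p ^ (n + 1) = 1 := root_cyclotomic_pow_eq_one _
  refine ⟨t, fun a => ?_⟩
  let S : AdjoinRoot Φ →ₗ[R] AdjoinRoot Φ :=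
    ∑ y : ZMod (p ^ (n + 1)), (t ∘ₗ LinearMap.mulLeft R (AdjoinRoot.root Φ ^ (-y).val)).smulRight
      (AdjoinRoot.root Φ ^ y.val)
  have hS : ∀ a, S a = ∑ y : ZMod (p ^ (n + 1)), t (AdjoinRoot.root Φ ^ (-y).val * a) •
      AdjoinRoot.root Φ ^ y.val := fun a => by simp [S]
  have hS1 : S 1 = AdjoinRoot.root Φ ^ p ^ n - 1 := by
    have h1 : ∀ y : ZMod (p ^ (n + 1)), t (AdjoinRoot.root Φ ^ (-y).val * 1) =
        (if y = (p ^ n : ℕ) then 1 else 0) - if y = 0 then 1 else 0 := fun y => by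
      rw [mul_one, ht, Nat.cast_add, ZMod.natCast_zmod_val]
      simp only [neg_eq_zero, neg_add_eq_zero]
    rw [hS]
    simp only [h1, sub_smul, ite_smul, one_smul, zero_smul, Finset.sum_sub_distrib,
      Finset.sum_ite_eq', Finset.mem_univ, if_true, ZMod.val_zero, pow_zero]
    rw [pow_zmod_val_natCast hζ]
  have hSζ : ∀ a, S (AdjoinRoot.root Φ * a) = AdjoinRoot.root Φ * S a := by
    intro a
    rw [hS, hS, Finset.mul_sum, ← Equiv.sum_comp (Equiv.addRight 1)]
    refine Finset.sum_congr rfl fun y _ => ?_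
    have h1 := pow_zmod_val_add_one hζ (-(y + 1))
    rw [neg_add_rev, neg_add_cancel_comm] at h1
    rw [Equiv.coe_addRight, pow_zmod_val_add_one hζ y, ← mul_assoc, neg_add_rev, ← h1,
      mul_smul_comm, mul_comm (AdjoinRoot.root Φ ^ y.val)]
  have hSm : ∀ m : ℕ, S (AdjoinRoot.root Φ ^ m) = (AdjoinRoot.root Φ ^ p ^ n - 1) *
      AdjoinRoot.root Φ ^ m := by
    intro m
    induction m with
    | zero => simpa using hS1
    | succ m ih => rw [pow_succ', hSζ, ih]; ring
  rw [← hS]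
  obtain ⟨f, rfl⟩ := AdjoinRoot.mk_surjective a
  have : S ∘ₗ (AdjoinRoot.mkₐ Φ).toLinearMap = LinearMap.mulLeft R (AdjoinRoot.root Φ ^ p ^ n - 1)
      ∘ₗ (AdjoinRoot.mkₐ Φ).toLinearMap := (basisMonomials R).ext fun j => by
    rw [hb]
    rw [LinearMap.comp_apply, LinearMap.comp_apply, LinearMap.mulLeft_apply,
      AlgHom.toLinearMap_apply, AdjoinRoot.coe_mkₐ, map_pow, AdjoinRoot.mk_X, hSm]
  exact LinearMap.congr_fun this f

end Duality

/-! ### Permutation summands for cyclic groups of prime power order -/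

/-- A module with an endomorphism `σ` such that `σ ^ N = 1` is a direct summand of a permutation
module: the identity factors equivariantly through the functions on a finite set with a permutation
of order dividing `N`. -/
def IsPermutationSummand {R M : Type*} [CommRing R] [AddCommGroup M] [Module R M]
    (σ : M →ₗ[R] M) (N : ℕ) : Prop :=
  ∃ (Y : Type) (_ : Fintype Y) (π : Equiv.Perm Y) (c : Y → M →ₗ[R] R) (m : Y → M),
    π ^ N = 1 ∧ (∀ y x, c (π y) (σ x) = c y x) ∧ (∀ y, m (π y) = σ (m y)) ∧
      ∀ x, ∑ y, c y x • m y = x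

section

variable {R : Type*} [CommRing R] [IsDomain R] [IsPrincipalIdealRing R]

theorem isPermutationSummand_one {M : Type*} [AddCommGroup M] [Module R M] [Module.Finite R M]
    [Module.IsTorsionFree R M] (N : ℕ) : IsPermutationSummand (1 : M →ₗ[R] M) N :=
  ⟨Fin (Module.finrank R M), inferInstance, 1, (Module.finBasis R M).coord, Module.finBasis R M,
    one_pow N, fun _ _ => rfl, fun _ => rfl, (Module.finBasis R M).sum_repr⟩

variable [IsLocalRing R] {p : ℕ} [hp : Fact p.Prime]

omit [IsPrincipalIdealRing R] in
-- If `ζ ^ p ^ n` were `1`, the relation `∑_{i < p} ζ ^ (p ^ n * i) = 0` would read `p = 0`.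
theorem root_cyclotomic_pow_sub_one_ne_zero (hpR : (p : R) ≠ 0) (n : ℕ) :
    AdjoinRoot.root (cyclotomic (p ^ (n + 1)) R) ^ p ^ n - 1 ≠ 0 := by
  intro h
  have h1 := congrArg (AdjoinRoot.mk (cyclotomic (p ^ (n + 1)) R))
    (cyclotomic_prime_pow_eq_geom_sum (R := R) (n := n) hp.out)
  simp only [AdjoinRoot.mk_self, map_sum, map_pow, AdjoinRoot.mk_X, sub_eq_zero.mp h, one_pow, Finset.sum_const,
    Finset.card_range, nsmul_eq_mul, mul_one] at h1
  have hinj := AdjoinRoot.of.injective_of_degree_ne_zero (f := cyclotomic (p ^ (n + 1)) R)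
    (degree_cyclotomic_pos _ _ (pow_pos hp.out.pos _)).ne'
  exact hpR (hinj (by simpa using h1.symm))

/-- The linear forms giving an equivariant lift of the coordinates of `τ x - x`, where `τ` is the
power of order `p` of an automorphism `σ` of order `p ^ (n + 1)`. -/
theorem exists_coordinate_lift {M : Type*} [AddCommGroup M] [Module R M] [Module.Finite R M]
    [Module.IsTorsionFree R M] (hpR : (p : R) ≠ 0)
    (hmax : IsLocalRing.maximalIdeal R = Ideal.span {(p : R)}) (n : ℕ) (σ : M →ₗ[R] M)
    (hσ : σ ^ p ^ (n + 1) = 1) :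
    ∃ (r : ℕ) (e : Fin r → M) (l : Fin r → M →ₗ[R] R),
      (∀ i, ∑ j ∈ Finset.range p, ((σ ^ p ^ n) ^ j) (e i) = 0) ∧
      ∀ x, (σ ^ p ^ n) x - x =
        ∑ i, ∑ y : ZMod (p ^ (n + 1)), l i ((σ ^ (-y).val) x) • (σ ^ y.val) (e i) := by
  let ν : M →ₗ[R] M := ∑ j ∈ Finset.range p, (σ ^ p ^ n) ^ j
  have hν : ∀ x, ν x = ∑ j ∈ Finset.range p, ((σ ^ p ^ n) ^ j) x := fun x => by simp [ν]
  have hcomm : Commute σ ν := Commute.sum_right _ _ _ fun j _ =>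
    ((Commute.refl σ).pow_right _).pow_right _
  have hνσ : ∀ x, ν (σ x) = σ (ν x) := fun x => (LinearMap.congr_fun hcomm x).symm
  have hντ : ∀ x, ν ((σ ^ p ^ n) x - x) = 0 := by
    intro x
    have : ν * (σ ^ p ^ n - 1) = 0 := by
      rw [geom_sum_mul, ← pow_mul, ← pow_succ, hσ, sub_self]
    exact LinearMap.congr_fun this x
  let L : Submodule R M := LinearMap.ker ν
  let σL : L →ₗ[R] L := σ.restrict fun x hx => by
    rw [LinearMap.mem_ker] at hx ⊢
    rw [hνσ, hx, map_zero]
  have hσL : ∀ k (x : L), ((σL ^ k) x : M) = (σ ^ k) x := by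
    intro k
    induction k with
    | zero => simp
    | succ k ih => intro x; rw [pow_succ, pow_succ]; exact ih _
  have hΦ : aeval σL (cyclotomic (p ^ (n + 1)) R) = 0 := by
    refine LinearMap.ext fun x => Subtype.ext ?_
    rw [cyclotomic_prime_pow_eq_geom_sum hp.out]
    simp only [map_sum, map_pow, aeval_X, LinearMap.sum_apply, LinearMap.zero_apply,
      Submodule.coe_zero, Submodule.coe_sum, ← pow_mul, hσL]
    simp only [pow_mul]
    rw [← hν]
    exact x.2
  -- An `R`-linear retraction, not assumed equivariant: it exists because the image of `ν` is
  -- torsion-free over `R`, hence free.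
  obtain ⟨pr, hpr⟩ : ∃ pr : M →ₗ[R] L, ∀ x : L, pr x = x := by
    obtain ⟨s, hs⟩ := Module.projective_lifting_property ν.rangeRestrict LinearMap.id
      ν.surjective_rangeRestrict
    have hs' : ∀ z, ν (s z) = z := fun z => congrArg Subtype.val (LinearMap.congr_fun hs z)
    have hmem : ∀ x, (LinearMap.id - s ∘ₗ ν.rangeRestrict : M →ₗ[R] M) x ∈ L := fun x => by
      rw [LinearMap.mem_ker, LinearMap.sub_apply, map_sub, LinearMap.comp_apply, hs']
      exact sub_self _
    refine ⟨(LinearMap.id - s ∘ₗ ν.rangeRestrict).codRestrict L hmem, fun x => Subtype.ext ?_⟩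
    have : ν.rangeRestrict x = 0 := Subtype.ext x.2
    rw [LinearMap.codRestrict_apply, LinearMap.sub_apply, LinearMap.comp_apply, this, map_zero,
      sub_zero, LinearMap.id_apply]
  obtain ⟨r, e, coord, hcoord, he⟩ := exists_coordinates_adjoinRoot_cyclotomic hpR hmax n σL hΦ
  have := (isPrincipalIdealRing_adjoinRoot_cyclotomic hpR hmax n).1
  set ζ := AdjoinRoot.root (cyclotomic (p ^ (n + 1)) R) with hζdef
  have hζ : ζ ^ p ^ (n + 1) = 1 := root_cyclotomic_pow_eq_one _
  have hcoord' : ∀ k i x, coord i ((σL ^ k) x) = ζ ^ k * coord i x := by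
    intro k i
    induction k with
    | zero => simp
    | succ k ih =>
      intro x
      rw [pow_succ σL, pow_succ ζ]
      change coord i ((σL ^ k) (σL x)) = _
      rw [ih, hcoord, mul_assoc]
  obtain ⟨t, ht⟩ : ∃ t : AdjoinRoot (cyclotomic (p ^ (n + 1)) R) →ₗ[R] R,
      ∀ a, ∑ y : ZMod (p ^ (n + 1)), t (ζ ^ (-y).val * a) • ζ ^ y.val = (ζ ^ p ^ n - 1) * a :=
    exists_linearForm_adjoinRoot_cyclotomic n
  let l : Fin r → M →ₗ[R] R := fun i => t ∘ₗ coord i ∘ₗ pr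
  let S : Fin r → M →ₗ[R] AdjoinRoot (cyclotomic (p ^ (n + 1)) R) := fun i =>
    ∑ y : ZMod (p ^ (n + 1)), (l i ∘ₗ σ ^ (-y).val).smulRight (ζ ^ y.val)
  have hS : ∀ i x, S i x = ∑ y : ZMod (p ^ (n + 1)), l i ((σ ^ (-y).val) x) • ζ ^ y.val :=
    fun i x => by simp [S]
  have hSσ : ∀ i x, S i (σ x) = ζ * S i x := by
    intro i x
    rw [hS, hS, Finset.mul_sum, ← Equiv.sum_comp (Equiv.addRight 1)]
    refine Finset.sum_congr rfl fun y _ => ?_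
    have h1 := LinearMap.congr_fun (pow_zmod_val_add_one hσ (-(y + 1))) x
    rw [neg_add_rev, neg_add_cancel_comm, Module.End.mul_apply] at h1
    rw [Equiv.coe_addRight, pow_zmod_val_add_one hζ y, neg_add_rev, ← h1, mul_smul_comm,
      mul_comm (ζ ^ y.val)]
  have hSτ : ∀ k i x, S i ((σ ^ k) x) = ζ ^ k * S i x := by
    intro k i
    induction k with
    | zero => simp
    | succ k ih =>
      intro x
      rw [pow_succ σ, pow_succ ζ, Module.End.mul_apply, ih, hSσ, mul_assoc]
  have hSL : ∀ i (x : L), S i x = (ζ ^ p ^ n - 1) * coord i x := by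
    intro i x
    rw [hS, ← ht]
    refine Finset.sum_congr rfl fun y _ => ?_
    rw [← hσL, ← hcoord']
    simp only [l, LinearMap.comp_apply, hpr]
  -- The formula is known on `L`. Applying it to `τ x - x ∈ L` gives both sides multiplied by `ζ ^ p
  -- ^ n - 1`, which cancels in the domain `R[ζ]`.
  have hSc : ∀ i x, S i x = coord i ⟨(σ ^ p ^ n) x - x, hντ x⟩ := by
    intro i x
    refine mul_left_cancel₀ (root_cyclotomic_pow_sub_one_ne_zero hpR n) ?_
    rw [← hSL, map_sub, hSτ, sub_mul, one_mul]
  refine ⟨r, fun i => e i, l, fun i => ?_, fun x => ?_⟩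
  · rw [← hν]
    exact (e i).2
  · have := he ⟨(σ ^ p ^ n) x - x, hντ x⟩
      (fun i => ∑ y : ZMod (p ^ (n + 1)), l i ((σ ^ (-y).val) x) • X ^ y.val) (fun i => by
        rw [← hSc, hS, ← AdjoinRoot.coe_mkₐ, map_sum]
        refine Finset.sum_congr rfl fun y _ => ?_
        rw [map_smul, map_pow, AdjoinRoot.coe_mkₐ, AdjoinRoot.mk_X])
    refine (congrArg Subtype.val this).trans ?_
    rw [Submodule.coe_sum]
    refine Finset.sum_congr rfl fun i _ => ?_
    rw [map_sum, LinearMap.sum_apply, Submodule.coe_sum]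
    refine Finset.sum_congr rfl fun y _ => ?_
    rw [map_smul, map_pow, aeval_X, LinearMap.smul_apply, Submodule.coe_smul, hσL]

/-- The last hypothesis is the vanishing of `Ĥ⁻¹` for every subgroup `⟨σ ^ p ^ k⟩`. It passes to the
fixed points of `σ ^ p ^ n`, and the rest of `M` is absorbed by a free module over the group ring.
-/
theorem isPermutationSummand_of_forall_exists (hpR : (p : R) ≠ 0)
    (hmax : IsLocalRing.maximalIdeal R = Ideal.span {(p : R)}) (n : ℕ) :
    ∀ {M : Type*} [AddCommGroup M] [Module R M] [Module.Finite R M] [Module.IsTorsionFree R M]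
      (σ : M →ₗ[R] M), σ ^ p ^ n = 1 →
      (∀ k ≤ n, ∀ x, ∑ i ∈ Finset.range (p ^ (n - k)), ((σ ^ p ^ k) ^ i) x = 0 →
        ∃ y, (σ ^ p ^ k) y - y = x) → IsPermutationSummand σ (p ^ n) := by
  induction n with
  | zero =>
    intro M _ _ _ _ σ hσ _
    rw [pow_zero, pow_one] at hσ
    rw [hσ]
    exact isPermutationSummand_one _
  | succ n ih =>
    intro M _ _ _ _ σ hσ hfl
    let M' : Submodule R M := LinearMap.ker (σ ^ p ^ n - 1)
    have hM' : ∀ x, x ∈ M' ↔ (σ ^ p ^ n) x = x := fun x => by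
      rw [LinearMap.mem_ker, LinearMap.sub_apply, sub_eq_zero, Module.End.one_apply]
    have hστ : ∀ k x, (σ ^ p ^ n) ((σ ^ k) x) = (σ ^ k) ((σ ^ p ^ n) x) := fun k x => by
      rw [← Module.End.mul_apply, ← Module.End.mul_apply, ← pow_add, ← pow_add, add_comm]
    let σ' : M' →ₗ[R] M' := σ.restrict fun x hx => by
      rw [hM'] at hx ⊢
      simpa [hx] using hστ 1 x
    have hσ' : ∀ k (x : M'), ((σ' ^ k) x : M) = (σ ^ k) x := by
      intro k
      induction k with
      | zero => simp
      | succ k ih => intro x; rw [pow_succ, pow_succ]; exact ih _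
    obtain ⟨Y, _, π, c, m, hπ, hc, hm, hcm⟩ := ih σ'
      (LinearMap.ext fun x => Subtype.ext (by rw [hσ']; exact (hM' _).mp x.2)) (by
      intro k hk x hx
      have hx' : ∑ i ∈ Finset.range (p ^ (n - k)), ((σ ^ p ^ k) ^ i) (x : M) = 0 := by
        have := congrArg Subtype.val hx
        rw [Submodule.coe_sum, Submodule.coe_zero] at this
        simpa only [← pow_mul, hσ'] using this
      have hpk : (σ ^ p ^ k) ^ p ^ (n - k) = σ ^ p ^ n := by
        rw [← pow_mul, ← pow_add, Nat.add_sub_cancel' hk]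
      have hfix : ∀ j, ((σ ^ p ^ k) ^ (p ^ (n - k) * j)) (x : M) = x := by
        intro j
        rw [pow_mul, hpk]
        induction j with
        | zero => simp
        | succ j ih => rw [pow_succ, Module.End.mul_apply, (hM' _).mp x.2, ih]
      -- For `j = p` this is the norm in `M`, which repeats the norm in `M'` `p` times.
      have hmul : ∀ j, ∑ i ∈ Finset.range (p ^ (n - k) * j), ((σ ^ p ^ k) ^ i) (x : M) = 0 := by
        intro j
        induction j with
        | zero => simp
        | succ j ih =>
          rw [Nat.mul_succ, Finset.sum_range_add, ih, zero_add, ← hx']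
          refine Finset.sum_congr rfl fun i _ => ?_
          rw [add_comm, pow_add, Module.End.mul_apply, hfix]
      obtain ⟨y, hy⟩ := hfl k (hk.trans n.le_succ) x (by
        rw [Nat.sub_add_comm hk, pow_succ]
        exact hmul p)
      refine ⟨⟨y, ?_⟩, Subtype.ext ?_⟩
      -- The solution lies in `M'` because `σ ^ p ^ n - 1` is the norm composed with `σ ^ p ^ k -
      -- 1`, so it sends `y` to the norm of `x`, which is zero.
      · have h1 := LinearMap.congr_fun (geom_sum_mul (σ ^ p ^ k) (p ^ (n - k))) y
        rw [hpk, Module.End.mul_apply, LinearMap.sub_apply, Module.End.one_apply, hy,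
          LinearMap.sum_apply, hx'] at h1
        exact h1.symm
      · rw [AddSubgroupClass.coe_sub, hσ']
        exact hy)
    obtain ⟨r, e, l, he, hl⟩ := exists_coordinate_lift hpR hmax n σ hσ
    choose m₀ hm₀ using fun i => hfl n n.le_succ (e i) (by simpa using he i)
    -- Since `τ (m₀ i) - m₀ i = e i`, the subtracted sum has the same image as `x` under `τ - 1`;
    -- hence `g₀` takes values in `M'`.
    let g₀ : M →ₗ[R] M := LinearMap.id - ∑ i, ∑ y : ZMod (p ^ (n + 1)),
      (l i ∘ₗ σ ^ (-y).val).smulRight ((σ ^ y.val) (m₀ i))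
    have hg₀ : ∀ x, g₀ x = x - ∑ i, ∑ y : ZMod (p ^ (n + 1)),
        l i ((σ ^ (-y).val) x) • (σ ^ y.val) (m₀ i) := fun x => by simp [g₀]
    have hg₀M : ∀ x, g₀ x ∈ M' := by
      intro x
      rw [hM', ← sub_eq_zero, hg₀, map_sub, sub_sub_sub_comm, hl x]
      simp only [map_sum, map_smul, hστ, ← Finset.sum_sub_distrib, ← smul_sub, ← map_sub, hm₀]
      simp
    let g : M →ₗ[R] M' := g₀.codRestrict M' hg₀M
    have hg : ∀ x, (g x : M) = g₀ x := fun _ => rfl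
    have hl1 : ∀ i (y : ZMod (p ^ (n + 1))) x,
        l i ((σ ^ (-(y + 1)).val) (σ x)) = l i ((σ ^ (-y).val) x) := by
      intro i y x
      have h1 := LinearMap.congr_fun (pow_zmod_val_add_one hσ (-(y + 1))) x
      rw [neg_add_rev, neg_add_cancel_comm, Module.End.mul_apply] at h1
      rw [neg_add_rev, ← h1]
    have hy1 : ∀ (y : ZMod (p ^ (n + 1))) x, (σ ^ (y + 1).val) x = σ ((σ ^ y.val) x) := by
      intro y x
      rw [pow_zmod_val_add_one hσ, ← pow_succ, pow_succ', Module.End.mul_apply]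
    have hgσ : ∀ x, g (σ x) = σ' (g x) := by
      intro x
      refine Subtype.ext ?_
      change g₀ (σ x) = σ (g₀ x)
      rw [hg₀, hg₀, map_sub, map_sum]
      congr 1
      refine Finset.sum_congr rfl fun i _ => ?_
      rw [map_sum, ← Equiv.sum_comp (Equiv.addRight 1)]
      refine Finset.sum_congr rfl fun y _ => ?_
      rw [Equiv.coe_addRight, hl1, map_smul, hy1]
    let ρ : Equiv.Perm (Fin r × ZMod (p ^ (n + 1))) :=
      (Equiv.refl _).prodCongr (Equiv.addRight 1)
    have hρ : ∀ (k : ℕ) z, (ρ ^ k) z = (z.1, z.2 + k) := by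
      intro k
      induction k with
      | zero => simp
      | succ k ih =>
        intro z
        rw [pow_succ' ρ, Equiv.Perm.mul_apply, ih]
        change (z.1, z.2 + k + 1) = _
        rw [add_assoc, Nat.cast_succ]
    refine ⟨Y ⊕ Fin r × ZMod (p ^ (n + 1)), inferInstance, Equiv.Perm.sumCongrHom _ _ (π, ρ),
      Sum.elim (fun y => c y ∘ₗ g) fun z => l z.1 ∘ₗ σ ^ (-z.2).val,
      Sum.elim (fun y => m y) fun z => (σ ^ z.2.val) (m₀ z.1), ?_, ?_, ?_, ?_⟩
    · have hπ' : π ^ p ^ (n + 1) = 1 := by rw [pow_succ, pow_mul, hπ, one_pow]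
      have : ρ ^ p ^ (n + 1) = 1 := Equiv.ext fun z => by
        rw [hρ, ZMod.natCast_self, add_zero, Equiv.Perm.one_apply]
      rw [← map_pow, Prod.pow_mk, hπ', this]
      exact map_one _
    · rintro (y | z) x
      · change c (π y) (g (σ x)) = c y (g x)
        rw [hgσ, hc]
      · exact hl1 _ _ _
    · rintro (y | z)
      · exact congrArg Subtype.val (hm y)
      · exact hy1 _ _
    · intro x
      rw [Fintype.sum_sum_type, Fintype.sum_prod_type]
      have := congrArg Subtype.val (hcm (g x))
      rw [Submodule.coe_sum, hg, hg₀] at this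
      refine (congrArg (· + _) this).trans ?_
      exact sub_add_cancel _ _

end

/-! ### Passage from the Sylow subgroup to `G` -/

namespace LocalizedModule

theorem exists_basis {A : Type*} [CommRing A] (S : Submonoid A) {M X : Type*} [AddCommGroup M]
    [Module A M] (b : Module.Basis X A M) :
    ∃ B : Module.Basis X (Localization S) (LocalizedModule S M), ∀ x, B x = mkLinearMap S M (b x) :=
  ⟨b.ofIsLocalizedModule (Localization S) S (mkLinearMap S M),
    b.ofIsLocalizedModule_apply (Localization S) S (mkLinearMap S M)⟩

theorem exists_smul_eq {A : Type*} [CommRing A] (S : Submonoid A) {M : Type*} [AddCommGroup M]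
    [Module A M] (x : LocalizedModule S M) :
    ∃ (s : (Localization S)ˣ) (m : M), s • x = mkLinearMap S M m := by
  obtain ⟨⟨m, s⟩, h⟩ := IsLocalizedModule.surj S (mkLinearMap S M) x
  refine ⟨(IsLocalization.map_units (Localization S) s).unit, m, ?_⟩
  rw [← h, Units.smul_def, IsUnit.unit_spec, algebraMap_smul]
  rfl

end LocalizedModule

namespace GLattice

section

variable {p : ℕ} [Fact p.Prime]

instance isDomain_localization : IsDomain (Localization (compl p)) :=
  IsLocalization.isDomain_localization compl_le_nonZeroDivisors

instance isPrincipalIdealRing_localization : IsPrincipalIdealRing (Localization (compl p)) :=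
  ⟨fun I => by
    rw [← IsLocalization.map_under (compl p) (Localization (compl p)) I,
      ← Ideal.span_singleton_generator (I.under ℤ),
      Ideal.map_span, Set.image_singleton]
    exact ⟨_, rfl⟩⟩

instance isLocalRing_localization : IsLocalRing (Localization (compl p)) :=
  inferInstanceAs (IsLocalRing (Localization.AtPrime (Ideal.span {(p : ℤ)})))

theorem maximalIdeal_localization :
    IsLocalRing.maximalIdeal (Localization (compl p)) =
      Ideal.span {(p : Localization (compl p))} := by
  have := Localization.AtPrime.map_eq_maximalIdeal (I := Ideal.span {(p : ℤ)})
  rw [Ideal.map_span, Set.image_singleton] at this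
  simpa using this.symm

theorem natCast_prime_ne_zero : (p : Localization (compl p)) ≠ 0 := by
  have hinj := IsLocalization.injective (Localization (compl p))
    (compl_le_nonZeroDivisors (p := p))
  rw [← map_natCast (algebraMap ℤ (Localization (compl p)))]
  exact (map_ne_zero_iff _ hinj).mpr (Int.natCast_ne_zero.mpr (Fact.out : p.Prime).ne_zero)

variable {G : Type} [Group G]

instance finite_localized (M : GLattice G) :
    Module.Finite (Localization (compl p)) (LocalizedModule (compl p) M.carrier) :=
  Module.Finite.of_basis
    (LocalizedModule.exists_basis (compl p) (Module.finBasis ℤ M.carrier)).choose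

/-- If the localization of `M` at `p` is a direct summand of a permutation module over a subgroup of
index prime to `p`, then `M` is `p`-invertible. -/
theorem isPInvertible_of_subgroup [Finite G] (M : GLattice G) (C : Subgroup G)
    (hC : ¬ p ∣ C.index) {Y : Type} [Fintype Y] [MulAction C Y]
    (c : Y → LocalizedModule (compl p) M.carrier →ₗ[Localization (compl p)]
      Localization (compl p))
    (m : Y → LocalizedModule (compl p) M.carrier)
    (hc : ∀ (h : C) y x, c (h • y) (M.localize p h x) = c y x)
    (hm : ∀ (h : C) y, m (h • y) = M.localize p h (m y))
    (hcm : ∀ x, ∑ y, c y x • m y = x) : M.IsPInvertible p := by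
  have := Fintype.ofFinite (G ⧸ C)
  have hκ : ∀ (g : G) (q : G ⧸ C), (g • q).out⁻¹ * g * q.out ∈ C := fun g q => by
    rw [mul_assoc, ← QuotientGroup.eq, QuotientGroup.out_eq', ← smul_eq_mul,
      ← MulAction.Quotient.smul_coe, QuotientGroup.out_eq']
  let κ : G → G ⧸ C → C := fun g q => ⟨_, hκ g q⟩
  have hκ' : ∀ (g : G) (q : G ⧸ C), (g • q).out * κ g q = g * q.out := fun g q => by
    simp [κ, mul_assoc]
  -- The induced `G`-set `G ×_C Y`, written with coset representatives; `κ` measures their failure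
  -- to be equivariant.
  let _ : MulAction G ((G ⧸ C) × Y) :=
    { smul := fun g z => (g • z.1, κ g z.1 • z.2)
      one_smul := fun z => by
        refine Prod.ext (one_smul G z.1) ?_
        have : κ 1 z.1 = 1 := Subtype.ext (by simp [κ])
        change κ 1 z.1 • z.2 = z.2
        rw [this, one_smul]
      mul_smul := fun g h z => by
        refine Prod.ext (mul_smul g h z.1) ?_
        have : κ (g * h) z.1 = κ g (h • z.1) * κ h z.1 := Subtype.ext (by
          simp [κ, mul_smul, mul_assoc])
        change κ (g * h) z.1 • z.2 = κ g (h • z.1) • κ h z.1 • z.2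
        rw [this, mul_smul] }
  have hsmul : ∀ (g : G) (z : (G ⧸ C) × Y), g • z = (g • z.1, κ g z.1 • z.2) := fun _ _ => rfl
  obtain ⟨u, hu⟩ : ∃ u : Localization (compl p), u * (C.index : ℕ) = 1 := by
    have h1 : ((C.index : ℕ) : ℤ) ∈ compl p := mem_compl_iff.mpr (by exact_mod_cast hC)
    obtain ⟨u, hu⟩ := (IsLocalization.map_units (Localization (compl p)) ⟨_, h1⟩).exists_left_inv
    exact ⟨u, by simpa using hu⟩
  let P := funLattice G ((G ⧸ C) × Y)
  obtain ⟨b, hb⟩ := exists_basis_funLattice (G := G) ((G ⧸ C) × Y)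
  obtain ⟨B, hB⟩ := LocalizedModule.exists_basis (compl p) b
  have hB' : ∀ (g : G) z, P.localize p g (B z) = B (g • z) := fun g z => by
    rw [hB, hB, ← hb]
    exact localize_toLocalized P g (b z)
  let i : LocalizedModule (compl p) M.carrier →ₗ[Localization (compl p)]
      LocalizedModule (compl p) P.carrier :=
    ∑ z : (G ⧸ C) × Y, (c z.2 ∘ₗ M.localize p z.1.out⁻¹).smulRight (B z)
  have hi : ∀ x, i x = ∑ z : (G ⧸ C) × Y, c z.2 (M.localize p z.1.out⁻¹ x) • B z :=
    fun x => by simp [i]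
  -- Each coset contributes `u • x` to `r (i x)`, so the factor `u = 1 / [G : C]` normalizes the
  -- sum.
  let r := B.constr (Localization (compl p)) fun z => u • M.localize p z.1.out (m z.2)
  have hr : ∀ z, r (B z) = u • M.localize p z.1.out (m z.2) := B.constr_basis _ _
  refine ⟨P, isPermutation_funLattice _, ⟨i, fun g => LinearMap.ext fun x => ?_⟩,
    ⟨r, fun g => B.ext fun z => ?_⟩, fun x => ?_⟩
  · rw [LinearMap.comp_apply, LinearMap.comp_apply, hi, hi, map_sum,
      ← Equiv.sum_comp (MulAction.toPerm g)]
    refine Finset.sum_congr rfl fun z _ => ?_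
    rw [MulAction.toPerm_apply, LinearMap.map_smul (P.localize p g), hB', hsmul]
    congr 1
    rw [← hc (κ g z.1) z.2, ← Module.End.mul_apply, ← Module.End.mul_apply, ← map_mul, ← map_mul]
    congr 3
    simp [κ]
  · rw [LinearMap.comp_apply, LinearMap.comp_apply, hB', hr, hr, map_smul, hsmul, hm,
      ← Module.End.mul_apply, ← Module.End.mul_apply, ← map_mul, ← map_mul, hκ']
  · change r (i x) = x
    rw [hi, map_sum, Fintype.sum_prod_type]
    have h1 : ∀ q : G ⧸ C, ∑ y, r (c y (M.localize p q.out⁻¹ x) • B (q, y)) = u • x := fun q => by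
      simp only [map_smul, hr, smul_comm _ u, ← Finset.smul_sum]
      simp only [← map_smul, ← map_sum, hcm]
      rw [← Module.End.mul_apply, ← map_mul, mul_inv_cancel, map_one, Module.End.one_apply]
    rw [Finset.sum_congr rfl fun q _ => h1 q, Finset.sum_const, Finset.card_univ,
      ← Nat.card_eq_fintype_card, ← Subgroup.index, ← Nat.cast_smul_eq_nsmul (Localization (compl p)),
      smul_smul, mul_comm, hu, one_smul]

theorem IsFlasque.exists_sub_eq [Finite G] {M : GLattice G} (hM : M.IsFlasque) (g : G)
    (x : M.carrier) (hx : ∑ i ∈ Finset.range (orderOf g), M.ρ (g ^ i) x = 0) :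
    ∃ y, M.ρ g y - y = x := by
  have := Fintype.ofFinite (Subgroup.zpowers g)
  obtain ⟨f, hf⟩ := (isFlasque_iff M).mp hM (Subgroup.zpowers g) x (by
    rw [← hx, Finset.sum_range]
    refine (Fintype.sum_equiv (finEquivZPowers (isOfFinOrder_of_finite g)) _ _ fun i => ?_).symm
    rfl)
  -- `g ^ n - 1` is a multiple of `g - 1`, so one generator accounts for the whole augmentation
  -- ideal.
  have h1 : ∀ (n : ℕ) z, ∃ y, M.ρ g y - y = M.ρ (g ^ n) z - z := fun n z => by
    have := LinearMap.congr_fun (mul_geom_sum (M.ρ g) n) z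
    refine ⟨_, this.trans ?_⟩
    rw [map_pow]
    rfl
  have h2 : ∀ h : Subgroup.zpowers g, ∃ y, M.ρ g y - y = M.ρ h (f h) - f h := fun h => by
    obtain ⟨n, hn⟩ := (isOfFinOrder_of_finite g).mem_powers_iff_mem_zpowers.mpr h.2
    rw [← hn]
    exact h1 n _
  choose y hy using h2
  refine ⟨∑ h, y h, ?_⟩
  rw [map_sum, ← Finset.sum_sub_distrib, hf]
  exact Finset.sum_congr rfl fun h _ => hy h

/-- If the `p`-Sylow subgroups of `G` are cyclic, then flasque lattices are `p`-invertible. -/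
theorem IsFlasque.isPInvertible [Finite G] {M : GLattice G} (hM : M.IsFlasque) (Gp : Sylow p G)
    [hG : IsCyclic Gp] : M.IsPInvertible p := by
  obtain ⟨g, hg⟩ := hG.exists_generator
  obtain ⟨n, hn⟩ := IsPGroup.iff_card.mp Gp.isPGroup'
  have hord : orderOf g = p ^ n := by
    rw [orderOf_eq_card_of_forall_mem_zpowers hg]
    exact hn
  have hord' : orderOf (g : G) = p ^ n := by rw [Subgroup.orderOf_coe, hord]
  set σ := M.localize p (g : G) with hσdef
  have hσ : σ ^ p ^ n = 1 := by rw [← map_pow, ← hord', pow_orderOf_eq_one, map_one]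
  obtain ⟨Y, _, π, c, m, hπ, hc, hm, hcm⟩ := isPermutationSummand_of_forall_exists
    natCast_prime_ne_zero maximalIdeal_localization n σ hσ (by
      intro k hk x hx
      -- A unit multiple of `x` comes from `M`, where flasqueness applies; dividing by the unit
      -- returns to `x`.
      obtain ⟨s, v, hv⟩ := LocalizedModule.exists_smul_eq (compl p) x
      have hpow : ∀ i, (σ ^ p ^ k) ^ i = M.localize p (((g : G) ^ p ^ k) ^ i) := fun i => by
        rw [map_pow, map_pow]
      have hord'' : orderOf ((g : G) ^ p ^ k) = p ^ (n - k) := by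
        rw [orderOf_pow_of_dvd (pow_pos (Fact.out : p.Prime).pos k).ne'
          (hord' ▸ pow_dvd_pow p hk), hord', Nat.pow_div hk (Fact.out : p.Prime).pos]
      obtain ⟨w, hw⟩ := hM.exists_sub_eq ((g : G) ^ p ^ k) v (by
        refine toLocalized_injective (p := p) M ?_
        rw [map_sum, map_zero, ← smul_zero s, ← hx, Finset.smul_sum, hord'']
        refine Finset.sum_congr rfl fun i _ => ?_
        rw [hpow, ← localize_toLocalized, Units.smul_def, ← map_smul]
        exact congrArg _ hv.symm)
      refine ⟨s⁻¹ • toLocalized p M w, ?_⟩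
      rw [← pow_one (σ ^ p ^ k), hpow, pow_one, Units.smul_def, map_smul, ← smul_sub,
        localize_toLocalized, ← map_sub, hw, ← Units.smul_def, inv_smul_eq_iff]
      exact hv.symm)
  let φ : Gp →* Equiv.Perm Y := monoidHomOfForallMemZpowers hg
    (hord ▸ orderOf_dvd_iff_pow_eq_one.mpr hπ)
  have hφ : φ g = π := monoidHomOfForallMemZpowers_apply_gen hg _
  let _ : MulAction (Gp : Subgroup G) Y := MulAction.compHom Y φ
  have hsmul : ∀ (h : (Gp : Subgroup G)) y, h • y = φ h y := fun _ _ => rfl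
  have hgen : ∀ h : Gp, ∃ k : ℕ, g ^ k = h := fun h =>
    (isOfFinOrder_of_finite g).mem_powers_iff_mem_zpowers.mpr (hg h)
  refine isPInvertible_of_subgroup M Gp ?_ c m (fun h => ?_) (fun h => ?_) hcm
  · exact Gp.not_dvd_index
  · obtain ⟨k, rfl⟩ := hgen h
    simp only [hsmul, map_pow, hφ, SubmonoidClass.coe_pow]
    induction k with
    | zero => simp
    | succ k ih =>
      intro y x
      rw [pow_succ', pow_succ', Equiv.Perm.mul_apply, Module.End.mul_apply, hc, ih]
  · obtain ⟨k, rfl⟩ := hgen h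
    simp only [hsmul, map_pow, hφ, SubmonoidClass.coe_pow]
    induction k with
    | zero => simp
    | succ k ih =>
      intro y
      rw [pow_succ', pow_succ', Equiv.Perm.mul_apply, Module.End.mul_apply, hm, ih]

end

end GLattice

theorem proposition5p1 (p : ℕ) [Fact p.Prime] (G : Type) [Group G] [Finite G] (Gp : Sylow p G) :
    List.TFAE
      [IsCyclic Gp,
       ∀ M : GLattice G, M.IsFlasque → M.IsPInvertible p,
       (GLattice.JG G).FlasqueClassIsPInvertible p] := by
  tfae_have 1 → 2 := fun _ _ hM => hM.isPInvertible Gp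
  tfae_have 2 → 3 := GLattice.flasqueClassIsPInvertible_JG
  tfae_have 3 → 1 := fun h => h.isCyclic Gp
  tfae_finish
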